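/- Fix $0<\delta<1$ and let $R_\delta=\{z\in\mathbb{C}:\delta<|z|<1\}$. For a holomorphic function $\varphi$ on $R_\delta$ put $\|\varphi\|_{\mathrm{dp}}=\sup\|\varphi(X)\|\in[0,\infty]$, where the supremum is over all bounded invertible operators $X$ on complex Hilbert spaces with $\|X\|\le 1$, $\|X^{-1}\|\le 1/\delta$ and spectrum $\sigma(X)\subseteq R_\delta$, and $\varphi(X)$ is defined by the Riesz–Dunford functional calculus. The dp-Schur class $\mathcal{S}_{\mathrm{dp}}$ is the set of holomorphic $\varphi$ on $R_\delta$ with $\|\varphi\|_{\mathrm{dp}}\le 1$. Theorem. Let $\lambda_1,\dots,\lambda_n\in R_\delta$ be distinct and let $z_1,\dots,z_n\in\mathbb{C}$. Suppose that the DP Pick problem $\lambda_j\mapsto z_j$, $j=1,\dots,n$, is solvable, that is, some $f\in\mathcal{S}_{\mathrm{dp}}$ satisfies $f(\lambda_j)=z_j$ for $j=1,\dots,n$. Then there is a rational function $\varphi$ with no poles in $R_\delta$ such that $\varphi\in\mathcal{S}_{\mathrm{dp}}$ and $\varphi(\lambda_j)=z_j$ for $j=1,\dots,n$, and there are a Hilbert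 space $\mathcal{M}=\mathcal{M}_1\oplus\mathcal{M}_2$ (orthogonal direct sum) with $\dim\mathcal{M}\le 2n$ and a holomorphic map $u:R_\delta\to\mathcal{M}$ such that $$1-\overline{\varphi(\mu)}\,\varphi(\lambda)=\big\langle (1-E(\mu)^*E(\lambda))\,u(\lambda),u(\mu)\big\rangle_{\mathcal{M}}\qquad\text{for all }\lambda,\mu\in R_\delta,$$ where $E(\lambda)=\begin{pmatrix}\lambda&0\\0&\delta/\lambda\end{pmatrix}$ with respect to the decomposition $\mathcal{M}=\mathcal{M}_1\oplus\mathcal{M}_2$. -/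

import Mathlib

open scoped ENNReal InnerProductSpace

universe v

noncomputable section

namespace DouglasPaulsen

/-- The annulus `R_δ = {z ∈ ℂ : δ < |z| < 1}`. -/
def annulus (δ : ℝ) : Set ℂ := {z : ℂ | δ < ‖z‖ ∧ ‖z‖ < 1}

section Calculus

variable {H : Type*} [NormedAddCommGroup H] [InnerProductSpace ℂ H] [CompleteSpace H]

/-- `X` is a Douglas–Paulsen operator with parameter `δ`: it is invertible, `‖X‖ ≤ 1`
and `‖X⁻¹‖ ≤ 1 / δ`. -/
def IsDPOperator (δ : ℝ) (X : H →L[ℂ] H) : Prop :=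
  IsUnit X ∧ ‖X‖ ≤ 1 ∧ ‖Ring.inverse X‖ ≤ 1 / δ

/-- The Douglas–Paulsen family: the Douglas–Paulsen operators with spectrum in `R_δ`. -/
def IsDPFamily (δ : ℝ) (X : H →L[ℂ] H) : Prop :=
  IsDPOperator δ X ∧ spectrum ℂ X ⊆ annulus δ

/-- The radii `p.1 < p.2` of two circles, both inside `R_δ`, such that the spectrum of `X` lies
strictly between the circles. -/
def IsContour (δ : ℝ) (X : H →L[ℂ] H) (p : ℝ × ℝ) : Prop :=
  δ < p.1 ∧ p.1 < p.2 ∧ p.2 < 1 ∧ spectrum ℂ X ⊆ {z : ℂ | p.1 < ‖z‖ ∧ ‖z‖ < p.2}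

/-- The Riesz–Dunford integral `(2πi)⁻¹ ∫_Γ f(ζ) (ζ - X)⁻¹ dζ`, where `Γ` is the circle
`|ζ| = p.2`, positively oriented, together with the circle `|ζ| = p.1`, negatively oriented. -/
def rieszDunford (f : ℂ → ℂ) (X : H →L[ℂ] H) (p : ℝ × ℝ) : H →L[ℂ] H :=
  (2 * Real.pi * Complex.I : ℂ)⁻¹ •
    ((∮ ζ in C(0, p.2), f ζ • resolvent X ζ) - ∮ ζ in C(0, p.1), f ζ • resolvent X ζ)

open Classical in
/-- The operator `f(X)` of the Riesz–Dunford functional calculus, for `f` holomorphic on `R_δ`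
and an operator `X` with spectrum in `R_δ`. By `exists_isContour` there is a contour, and by
`rieszDunford_eq` the operator does not depend on which one is chosen. -/
def holCalc (δ : ℝ) (f : ℂ → ℂ) (X : H →L[ℂ] H) : H →L[ℂ] H :=
  if h : ∃ p : ℝ × ℝ, IsContour δ X p then rieszDunford f X h.choose else 0

theorem exists_isContour {δ : ℝ} (hδ : δ < 1) {X : H →L[ℂ] H}
    (hX : spectrum ℂ X ⊆ annulus δ) : ∃ p : ℝ × ℝ, IsContour δ X p := by
  rcases (spectrum ℂ X).eq_empty_or_nonempty with h | h
  · refine ⟨(δ + (1 - δ) / 3, δ + 2 * (1 - δ) / 3), ?_, ?_, ?_, by simp [h]⟩ <;> simp only <;>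
      linarith
  · obtain ⟨a, ha, ha'⟩ := (spectrum.isCompact X).exists_isMinOn h continuous_norm.continuousOn
    obtain ⟨b, hb, hb'⟩ := (spectrum.isCompact X).exists_isMaxOn h continuous_norm.continuousOn
    have h1 := (hX ha).1
    have h2 := (hX hb).2
    have h3 : ‖a‖ ≤ ‖b‖ := ha' hb
    refine ⟨((δ + ‖a‖) / 2, (1 + ‖b‖) / 2), ?_, ?_, ?_, fun z hz => ⟨?_, ?_⟩⟩ <;> simp only
    · linarith
    · linarith
    · linarith
    · have : ‖a‖ ≤ ‖z‖ := ha' hz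
      linarith
    · have : ‖z‖ ≤ ‖b‖ := hb' hz
      linarith

theorem circleIntegral_resolvent_eq {δ : ℝ} (hδ : 0 < δ) {f : ℂ → ℂ}
    (hf : DifferentiableOn ℂ f (annulus δ)) {X : H →L[ℂ] H} {r s : ℝ} (hr : δ < r) (hrs : r ≤ s)
    (hs : s < 1) (hX : ∀ z : ℂ, r ≤ ‖z‖ → ‖z‖ ≤ s → z ∉ spectrum ℂ X) :
    (∮ ζ in C(0, s), f ζ • resolvent X ζ) = ∮ ζ in C(0, r), f ζ • resolvent X ζ := by
  have hopen : IsOpen (annulus δ) :=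
    (isOpen_lt continuous_const continuous_norm).inter (isOpen_lt continuous_norm continuous_const)
  have key : ∀ z : ℂ, r ≤ ‖z‖ → ‖z‖ ≤ s →
      DifferentiableAt ℂ (fun ζ => f ζ • resolvent X ζ) z := fun z h1 h2 =>
    ((hf z ⟨by linarith, by linarith⟩).differentiableAt
      (hopen.mem_nhds ⟨by linarith, by linarith⟩)).smul
      (spectrum.hasDerivAt_resolvent_const_left (spectrum.notMem_iff.1 (hX z h1 h2))).differentiableAt
  refine Complex.circleIntegral_eq_of_differentiable_on_annulus_off_countable (by linarith) hrs
    Set.countable_empty (fun z hz => ?_) (fun z hz => ?_)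
  · simp only [Set.mem_sdiff, Metric.mem_closedBall, Metric.mem_ball, dist_zero_right, not_lt] at hz
    exact (key z hz.2 hz.1).continuousAt.continuousWithinAt
  · simp only [Set.mem_sdiff, Metric.mem_closedBall, Metric.mem_ball, dist_zero_right, not_le,
      Set.mem_empty_iff_false, not_false_eq_true, and_true] at hz
    exact key z hz.2.le hz.1.le

theorem rieszDunford_eq {δ : ℝ} (hδ : 0 < δ) {f : ℂ → ℂ}
    (hf : DifferentiableOn ℂ f (annulus δ)) {X : H →L[ℂ] H} {p q : ℝ × ℝ}
    (hp : IsContour δ X p) (hq : IsContour δ X q) : rieszDunford f X p = rieszDunford f X q := by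
  obtain ⟨p1, p2, p3, p4⟩ := hp
  obtain ⟨q1, q2, q3, q4⟩ := hq
  have hout : (∮ ζ in C(0, p.2), f ζ • resolvent X ζ) = ∮ ζ in C(0, q.2), f ζ • resolvent X ζ := by
    rcases le_total p.2 q.2 with h | h
    · exact (circleIntegral_resolvent_eq hδ hf (by linarith) h q3
        fun z h1 _ hz => (p4 hz).2.not_ge h1).symm
    · exact circleIntegral_resolvent_eq hδ hf (by linarith) h p3
        fun z h1 _ hz => (q4 hz).2.not_ge h1
  have hin : (∮ ζ in C(0, p.1), f ζ • resolvent X ζ) = ∮ ζ in C(0, q.1), f ζ • resolvent X ζ := by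
    rcases le_total p.1 q.1 with h | h
    · exact (circleIntegral_resolvent_eq hδ hf p1 h (by linarith)
        fun z _ h2 hz => (q4 hz).1.not_ge h2).symm
    · exact circleIntegral_resolvent_eq hδ hf q1 h (by linarith)
        fun z _ h2 hz => (p4 hz).1.not_ge h2
  rw [rieszDunford, rieszDunford, hout, hin]

end Calculus

/-- The Douglas–Paulsen norm `sup ‖f(X)‖`, over all operators `X` in the Douglas–Paulsen family on
all complex Hilbert spaces (in the universe `v`), with values in `[0, ∞]`. -/
def dpNorm (δ : ℝ) (f : ℂ → ℂ) : ℝ≥0∞ :=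
  ⨆ (H : Type v) (_ : NormedAddCommGroup H) (_ : InnerProductSpace ℂ H) (_ : CompleteSpace H)
    (X : H →L[ℂ] H) (_ : IsDPFamily δ X), ENNReal.ofReal ‖holCalc δ f X‖

/-- The dp-Schur class: the holomorphic functions on `R_δ` of dp-norm at most `1`. A function on
`R_δ` is represented by a function on `ℂ`, whose values off `R_δ` are irrelevant. -/
def dpSchur (δ : ℝ) : Set (ℂ → ℂ) :=
  {f | DifferentiableOn ℂ f (annulus δ) ∧ dpNorm.{v} δ f ≤ 1}

/-- The DP Pick problem `lam j ↦ z j` is solvable. -/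
def DPPickSolvable (δ : ℝ) {n : ℕ} (lam z : Fin n → ℂ) : Prop :=
  ∃ f ∈ dpSchur.{v} δ, ∀ j, f (lam j) = z j

/-- On the set `S`, `f` is a quotient of polynomials whose denominator has no zero in `S`. -/
def IsRationalOn (f : ℂ → ℂ) (S : Set ℂ) : Prop :=
  ∃ p q : Polynomial ℂ, ∀ z ∈ S, q.eval z ≠ 0 ∧ f z = p.eval z / q.eval z

section Model

variable {M₁ M₂ : Type*} [NormedAddCommGroup M₁] [InnerProductSpace ℂ M₁]
  [NormedAddCommGroup M₂] [InnerProductSpace ℂ M₂]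

/-- The operator `E(w) = w ⊕ δ / w` on the orthogonal direct sum `M₁ ⊕ M₂`. -/
def modelOp (δ : ℝ) (M₁ M₂ : Type*) [NormedAddCommGroup M₁] [InnerProductSpace ℂ M₁]
    [NormedAddCommGroup M₂] [InnerProductSpace ℂ M₂] (w : ℂ) :
    WithLp 2 (M₁ × M₂) →L[ℂ] WithLp 2 (M₁ × M₂) :=
  ((WithLp.prodContinuousLinearEquiv 2 ℂ M₁ M₂).symm : M₁ × M₂ →L[ℂ] WithLp 2 (M₁ × M₂)) ∘L
    (w • ContinuousLinearMap.id ℂ M₁).prodMap (((δ : ℂ) / w) • ContinuousLinearMap.id ℂ M₂) ∘L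
    (WithLp.prodContinuousLinearEquiv 2 ℂ M₁ M₂ : WithLp 2 (M₁ × M₂) →L[ℂ] M₁ × M₂)

/-- `(M₁ ⊕ M₂, u)` is a DP-model of `f`: for all `w, m ∈ R_δ`,
`1 - conj (f m) * f w = ⟨(1 - E(m)^* E(w)) u(w), u(m)⟩`. The inner product is linear in its first
argument in the formula just written, and in its second argument in Mathlib. -/
def IsDPModel [CompleteSpace M₁] [CompleteSpace M₂] (δ : ℝ) (f : ℂ → ℂ)
    (u : ℂ → WithLp 2 (M₁ × M₂)) : Prop :=
  ∀ w ∈ annulus δ, ∀ m ∈ annulus δ,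
    1 - (starRingEnd ℂ) (f m) * f w =
      ⟪u m, (1 - ContinuousLinearMap.adjoint (modelOp δ M₁ M₂ m) * modelOp δ M₁ M₂ w) (u w)⟫_ℂ

end Model

end DouglasPaulsen

end

noncomputable section

namespace DouglasPaulsen

/-! On finitely many nodes the problem becomes linear algebra. If `f` is in the dp-Schur class, its
Pick matrix `1 - conj (f λᵢ) f λⱼ` is a sum of two positive matrices, one weighted by `1 - conj λᵢ
λⱼ` and the other by `1 - conj (δ/λᵢ) (δ/λⱼ)` (`szegoWeight_mem_pickCone`). Such sums form a closed
convex cone. A Pick matrix outside it would be separated from it by a Hermitian `H` whose two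
weighted Hadamard products are positive. Then `H` is itself positive and, after a small
perturbation, is the Gram matrix of a basis of eigenvectors, with eigenvalues `λᵢ`, of an operator
`X` in the Douglas–Paulsen family. The bound `‖f(X)‖ ≤ 1` contradicts the separation.

Given the decomposition, factor the two positive matrices and move the negative terms across: two
Gram matrices agree, which yields an isometry `V` on `ℂ ⊕ ℂⁿ ⊕ ℂⁿ`
(`exists_interpolating_isometry`). Solving `V (1, E u) = (φ, u)` over the whole annulus gives
rational `φ` and `u` (`exists_realization`). Since `V` preserves inner products, this equation is
the model formula (`isDPModel_of_isometry`); read in the functional calculus, it is the norm bound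
(`mem_dpSchur_of_isometry`). -/

theorem isOpen_annulus (δ : ℝ) : IsOpen (annulus δ) :=
  (isOpen_lt continuous_const continuous_norm).inter (isOpen_lt continuous_norm continuous_const)

theorem sphere_subset_annulus {δ r : ℝ} (h1 : δ < r) (h2 : r < 1) :
    Metric.sphere (0 : ℂ) r ⊆ annulus δ := by
  intro z hz
  rw [mem_sphere_zero_iff_norm] at hz
  exact ⟨by rw [hz]; exact h1, by rw [hz]; exact h2⟩

theorem circleIntegral_comp_comm {E F : Type*} [NormedAddCommGroup E]
    [NormedSpace ℂ E] [CompleteSpace E] [NormedAddCommGroup F] [NormedSpace ℂ F] [CompleteSpace F]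
    (L : E →L[ℂ] F) {f : ℂ → E} {R : ℝ} (hf : CircleIntegrable f 0 R) :
    (∮ z in C(0, R), L (f z)) = L (∮ z in C(0, R), f z) := by
  simp only [circleIntegral]
  rw [← L.intervalIntegral_comp_comm hf.out]
  simp

/-! ### The Riesz–Dunford calculus on the annulus. -/

section Calculus

variable {H : Type*} [NormedAddCommGroup H] [InnerProductSpace ℂ H] [CompleteSpace H]

theorem continuousOn_resolvent (X : H →L[ℂ] H) : ContinuousOn (resolvent X) (spectrum ℂ X)ᶜ :=
  fun _ hz => (spectrum.hasDerivAt_resolvent_const_left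
    (spectrum.notMem_iff.1 hz)).continuousAt.continuousWithinAt

omit [CompleteSpace H] in
theorem IsContour.sphere_subset {δ : ℝ} {X : H →L[ℂ] H} {p : ℝ × ℝ} (hp : IsContour δ X p)
    {r : ℝ} (hr : r = p.1 ∨ r = p.2) : Metric.sphere (0 : ℂ) r ⊆ (spectrum ℂ X)ᶜ := by
  intro z hz hz'
  rw [mem_sphere_zero_iff_norm] at hz
  have := hp.2.2.2 hz'
  simp only [Set.mem_ofPred_eq] at this
  rcases hr with rfl | rfl
  · exact absurd hz this.1.ne'
  · exact absurd hz this.2.ne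

theorem IsContour.circleIntegrable {δ : ℝ} (hδ : 0 < δ) {f : ℂ → ℂ}
    (hf : DifferentiableOn ℂ f (annulus δ)) {X : H →L[ℂ] H} {p : ℝ × ℝ} (hp : IsContour δ X p)
    {r : ℝ} (hr : r = p.1 ∨ r = p.2) :
    CircleIntegrable (fun ζ => f ζ • resolvent X ζ) 0 r := by
  have h1 := hp.1
  have h2 := hp.2.1
  have h3 := hp.2.2.1
  refine ContinuousOn.circleIntegrable (by rcases hr with rfl | rfl <;> linarith) ?_
  refine ContinuousOn.smul (hf.continuousOn.mono (sphere_subset_annulus ?_ ?_))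
    ((continuousOn_resolvent X).mono (hp.sphere_subset hr)) <;> rcases hr with rfl | rfl <;> linarith

theorem holCalc_eq {δ : ℝ} (hδ : 0 < δ) {f : ℂ → ℂ} (hf : DifferentiableOn ℂ f (annulus δ))
    {X : H →L[ℂ] H} {p : ℝ × ℝ} (hp : IsContour δ X p) : holCalc δ f X = rieszDunford f X p := by
  have h : ∃ p : ℝ × ℝ, IsContour δ X p := ⟨p, hp⟩
  rw [holCalc, dif_pos h]
  exact rieszDunford_eq hδ hf h.choose_spec hp

variable {δ : ℝ} {X : H →L[ℂ] H}

theorem holCalc_congr (hδ : 0 < δ) (hδ1 : δ < 1) (hX : spectrum ℂ X ⊆ annulus δ) {f g : ℂ → ℂ}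
    (hf : DifferentiableOn ℂ f (annulus δ)) (hfg : Set.EqOn f g (annulus δ)) :
    holCalc δ f X = holCalc δ g X := by
  obtain ⟨p, hp⟩ := exists_isContour hδ1 hX
  have h1 := hp.1
  have h2 := hp.2.1
  have h3 := hp.2.2.1
  rw [holCalc_eq hδ hf hp, holCalc_eq hδ (hf.congr fun z hz => (hfg hz).symm) hp, rieszDunford,
    rieszDunford]
  congr 2 <;> refine circleIntegral.integral_congr (by linarith) fun z hz => ?_ <;>
    rw [hfg (sphere_subset_annulus (by linarith) (by linarith) hz)]

theorem holCalc_sum (hδ : 0 < δ) (hδ1 : δ < 1) (hX : spectrum ℂ X ⊆ annulus δ) {ι : Type*}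
    (s : Finset ι) (c : ι → ℂ) {g : ι → ℂ → ℂ}
    (hg : ∀ i, DifferentiableOn ℂ (g i) (annulus δ)) :
    holCalc δ (fun w => ∑ i ∈ s, c i * g i w) X = ∑ i ∈ s, c i • holCalc δ (g i) X := by
  obtain ⟨p, hp⟩ := exists_isContour hδ1 hX
  have key : ∀ r : ℝ, r = p.1 ∨ r = p.2 →
      (∮ ζ in C(0, r), (∑ i ∈ s, c i * g i ζ) • resolvent X ζ) =
        ∑ i ∈ s, c i • ∮ ζ in C(0, r), g i ζ • resolvent X ζ := by
    intro r hr
    simp_rw [Finset.sum_smul, mul_smul]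
    rw [circleIntegral.integral_fun_sum]
    · simp_rw [circleIntegral.integral_smul]
    · intro i _
      exact IntervalIntegrable.smul (hp.circleIntegrable hδ (hg i) hr) (c i)
  rw [holCalc_eq hδ (DifferentiableOn.fun_sum fun i _ => (hg i).const_mul _) hp, rieszDunford,
    key _ (Or.inl rfl), key _ (Or.inr rfl), ← Finset.sum_sub_distrib, Finset.smul_sum]
  refine Finset.sum_congr rfl fun i _ => ?_
  rw [holCalc_eq hδ (hg i) hp, rieszDunford, ← smul_sub, smul_comm]

omit [CompleteSpace H] in
theorem smul_resolvent_eq {ζ : ℂ} (hζ : ζ ∉ spectrum ℂ X) :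
    ζ • resolvent X ζ = 1 + X * resolvent X ζ := by
  have h := (spectrum.notMem_iff.1 hζ)
  have h2 : (algebraMap ℂ (H →L[ℂ] H) ζ - X) * resolvent X ζ = 1 := Ring.mul_inverse_cancel _ h
  rw [sub_mul, sub_eq_iff_eq_add, Algebra.algebraMap_eq_smul_one, smul_mul_assoc, one_mul] at h2
  exact h2

omit [CompleteSpace H] in
theorem commute_resolvent {ζ : ℂ} (hζ : ζ ∉ spectrum ℂ X) :
    X * resolvent X ζ = resolvent X ζ * X := by
  have h := (spectrum.notMem_iff.1 hζ)
  have h2 : resolvent X ζ * (algebraMap ℂ (H →L[ℂ] H) ζ - X) = 1 := Ring.inverse_mul_cancel _ h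
  rw [mul_sub, sub_eq_iff_eq_add, Algebra.algebraMap_eq_smul_one, mul_smul_comm, mul_one,
    smul_resolvent_eq hζ] at h2
  exact add_left_cancel h2

theorem circleIntegral_eq_of_differentiableOn_annulus (hδ : 0 < δ) {f : ℂ → ℂ}
    (hf : DifferentiableOn ℂ f (annulus δ)) {r s : ℝ} (hr : δ < r) (hrs : r ≤ s) (hs : s < 1) :
    (∮ ζ in C(0, s), f ζ) = ∮ ζ in C(0, r), f ζ := by
  have key : ∀ z : ℂ, r ≤ ‖z‖ → ‖z‖ ≤ s → DifferentiableAt ℂ f z := fun z h1 h2 =>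
    (hf z ⟨by linarith, by linarith⟩).differentiableAt
      ((isOpen_annulus δ).mem_nhds ⟨by linarith, by linarith⟩)
  refine Complex.circleIntegral_eq_of_differentiable_on_annulus_off_countable (by linarith) hrs
    Set.countable_empty (fun z hz => ?_) (fun z hz => ?_)
  · simp only [Set.mem_sdiff, Metric.mem_closedBall, Metric.mem_ball, dist_zero_right, not_lt] at hz
    exact (key z hz.2 hz.1).continuousAt.continuousWithinAt
  · simp only [Set.mem_sdiff, Metric.mem_closedBall, Metric.mem_ball, dist_zero_right, not_le,
      Set.mem_empty_iff_false, not_false_eq_true, and_true] at hz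
    exact key z hz.2.le hz.1.le

/-- Under the integral, `ζ R(ζ) = 1 + X R(ζ)` for the resolvent `R`. The scalar terms `∮ f` over the
two circles cancel by Cauchy's theorem. -/
theorem holCalc_id_mul (hδ : 0 < δ) (hδ1 : δ < 1) (hX : spectrum ℂ X ⊆ annulus δ) {f : ℂ → ℂ}
    (hf : DifferentiableOn ℂ f (annulus δ)) :
    holCalc δ (fun w => w * f w) X = X * holCalc δ f X := by
  obtain ⟨p, hp⟩ := exists_isContour hδ1 hX
  have h1 := hp.1
  have h2 := hp.2.1
  have h3 := hp.2.2.1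
  have key : ∀ r : ℝ, r = p.1 ∨ r = p.2 →
      (∮ ζ in C(0, r), (ζ * f ζ) • resolvent X ζ) =
        (∮ ζ in C(0, r), f ζ) • (1 : H →L[ℂ] H) + X * ∮ ζ in C(0, r), f ζ • resolvent X ζ := by
    intro r hr
    have hr0 : 0 ≤ r := by rcases hr with rfl | rfl <;> linarith
    have hfi : CircleIntegrable f 0 r := by
      refine (hf.continuousOn.mono (sphere_subset_annulus ?_ ?_)).circleIntegrable hr0 <;>
        rcases hr with rfl | rfl <;> linarith
    have e1 : (∮ ζ in C(0, r), (ζ * f ζ) • resolvent X ζ) =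
        ∮ ζ in C(0, r), (f ζ • (1 : H →L[ℂ] H) + X * (f ζ • resolvent X ζ)) := by
      refine circleIntegral.integral_congr hr0 fun z hz => ?_
      rw [mul_comm, mul_smul, smul_resolvent_eq (hp.sphere_subset hr hz), smul_add, mul_smul_comm]
    have hi := hp.circleIntegrable hδ hf hr
    rw [e1, circleIntegral.integral_add, circleIntegral.integral_smul_const]
    · congr 1
      exact circleIntegral_comp_comm
        (ContinuousLinearMap.mul ℂ (H →L[ℂ] H) X) hi
    · refine ContinuousOn.circleIntegrable hr0 (ContinuousOn.smul
        (hf.continuousOn.mono (sphere_subset_annulus ?_ ?_)) continuousOn_const) <;>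
        rcases hr with rfl | rfl <;> linarith
    · refine ContinuousOn.circleIntegrable hr0 (continuousOn_const.mul (ContinuousOn.smul
        (hf.continuousOn.mono (sphere_subset_annulus ?_ ?_))
        ((continuousOn_resolvent X).mono (hp.sphere_subset hr)))) <;>
        rcases hr with rfl | rfl <;> linarith
  rw [holCalc_eq hδ (f := fun w => w * f w) (differentiableOn_id.mul hf) hp, holCalc_eq hδ hf hp, rieszDunford,
    rieszDunford, mul_smul_comm, mul_sub]
  have := key _ (Or.inl rfl)
  have h' := key _ (Or.inr rfl)
  rw [this, h', circleIntegral_eq_of_differentiableOn_annulus hδ hf h1 h2.le h3]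
  congr 1
  abel

theorem commute_holCalc (hδ : 0 < δ) (hδ1 : δ < 1) (hX : spectrum ℂ X ⊆ annulus δ) {f : ℂ → ℂ}
    (hf : DifferentiableOn ℂ f (annulus δ)) : X * holCalc δ f X = holCalc δ f X * X := by
  obtain ⟨p, hp⟩ := exists_isContour hδ1 hX
  have h1 := hp.1
  have h2 := hp.2.1
  have key : ∀ r : ℝ, r = p.1 ∨ r = p.2 →
      X * (∮ ζ in C(0, r), f ζ • resolvent X ζ) = (∮ ζ in C(0, r), f ζ • resolvent X ζ) * X := by
    intro r hr
    have hi := hp.circleIntegrable hδ hf hr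
    have e1 := circleIntegral_comp_comm
      (ContinuousLinearMap.mul ℂ (H →L[ℂ] H) X) hi
    have e2 := circleIntegral_comp_comm
      ((ContinuousLinearMap.mul ℂ (H →L[ℂ] H)).flip X) hi
    simp only [ContinuousLinearMap.flip_apply, ContinuousLinearMap.mul_apply'] at e1 e2
    rw [← e1, ← e2]
    refine circleIntegral.integral_congr (by rcases hr with rfl | rfl <;> linarith) fun z hz => ?_
    rw [mul_smul_comm, smul_mul_assoc, commute_resolvent (hp.sphere_subset hr hz)]
  rw [holCalc_eq hδ hf hp, rieszDunford, mul_smul_comm, smul_mul_assoc, mul_sub, sub_mul,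
    key _ (Or.inl rfl), key _ (Or.inr rfl)]

theorem circleIntegral_resolvent_of_lt_spectrum {r : ℝ} (hr : 0 < r)
    (h : ∀ z ∈ spectrum ℂ X, r < ‖z‖) : (∮ ζ in C(0, r), resolvent X ζ) = 0 := by
  have hz : ∀ z ∈ Metric.closedBall (0 : ℂ) r, z ∉ spectrum ℂ X := fun z hz hz' => by
    rw [mem_closedBall_zero_iff] at hz
    exact (h z hz').not_ge hz
  refine Complex.circleIntegral_eq_zero_of_differentiable_on_off_countable hr.le
    Set.countable_empty ((continuousOn_resolvent X).mono hz) fun z hz' => ?_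
  exact (spectrum.hasDerivAt_resolvent_const_left (spectrum.notMem_iff.1
    (hz z (Metric.ball_subset_closedBall hz'.1)))).differentiableAt

/-- The integral does not change when the circle grows. Writing `R(ζ) = ζ⁻¹ + ζ⁻¹ X R(ζ)`, the first
term contributes `2πi` and the second vanishes in the limit because the resolvent tends to zero at
infinity. -/
theorem circleIntegral_resolvent_of_spectrum_lt {r : ℝ} (hr : 0 < r)
    (h : ∀ z ∈ spectrum ℂ X, ‖z‖ < r) :
    (∮ ζ in C(0, r), resolvent X ζ) = (2 * Real.pi * Complex.I : ℂ) • 1 := by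
  have hz : ∀ z : ℂ, r ≤ ‖z‖ → z ∉ spectrum ℂ X := fun z hz hz' => (h z hz').not_ge hz
  have hcont : ∀ R : ℝ, r ≤ R → ContinuousOn (resolvent X : ℂ → H →L[ℂ] H) (Metric.sphere 0 R) := fun R hR =>
    (continuousOn_resolvent X).mono fun z hz' => hz z (by
      rw [mem_sphere_zero_iff_norm] at hz'; rw [hz']; exact hR)
  have hcinv : ∀ R : ℝ, r ≤ R → ContinuousOn (fun z : ℂ => z⁻¹) (Metric.sphere 0 R) :=
    fun R hR => continuousOn_inv₀.mono fun z hz' h0 => by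
      rw [mem_sphere_zero_iff_norm, Set.mem_singleton_iff.1 h0, norm_zero] at hz'; linarith
  have hconst : ∀ R : ℝ, r ≤ R → (∮ ζ in C(0, R), resolvent X ζ) = ∮ ζ in C(0, r), resolvent X ζ := by
    intro R hR
    refine Complex.circleIntegral_eq_of_differentiable_on_annulus_off_countable hr hR
      Set.countable_empty ((continuousOn_resolvent X).mono fun z hz' => ?_) (fun z hz' => ?_)
    · simp only [Set.mem_sdiff, Metric.mem_closedBall, Metric.mem_ball, dist_zero_right,
        not_lt] at hz'
      exact hz z hz'.2
    · simp only [Set.mem_sdiff, Metric.mem_closedBall, Metric.mem_ball, dist_zero_right, not_le,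
        Set.mem_empty_iff_false, not_false_eq_true, and_true] at hz'
      exact (spectrum.hasDerivAt_resolvent_const_left (spectrum.notMem_iff.1
        (hz z hz'.2.le))).differentiableAt
  have hsplit : ∀ R : ℝ, r ≤ R → (∮ ζ in C(0, R), resolvent X ζ) =
      (2 * Real.pi * Complex.I : ℂ) • (1 : H →L[ℂ] H) +
        ∮ ζ in C(0, R), ζ⁻¹ • (X * resolvent X ζ) := by
    intro R hR
    have hR0 : 0 < R := hr.trans_le hR
    have e1 : (∮ ζ in C(0, R), resolvent X ζ) =
        ∮ ζ in C(0, R), (ζ⁻¹ • (1 : H →L[ℂ] H) + ζ⁻¹ • (X * resolvent X ζ)) := by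
      refine circleIntegral.integral_congr hR0.le fun z hz' => ?_
      rw [mem_sphere_zero_iff_norm] at hz'
      have hz0 : z ≠ 0 := by rintro rfl; rw [norm_zero] at hz'; linarith
      rw [← smul_add, ← smul_resolvent_eq (hz z (by rw [hz']; exact hR)), smul_smul,
        inv_mul_cancel₀ hz0, one_smul]
    rw [e1, circleIntegral.integral_add, circleIntegral.integral_smul_const]
    · have := circleIntegral.integral_sub_center_inv (0 : ℂ) hR0.ne'
      simp only [sub_zero] at this
      rw [this]
    · exact ((hcinv R hR).smul continuousOn_const).circleIntegrable hR0.le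
    · exact ((hcinv R hR).smul (continuousOn_const.mul (hcont R hR))).circleIntegrable hR0.le
  have hlim : ∀ ε : ℝ, 0 < ε →
      ‖(∮ ζ in C(0, r), resolvent X ζ) - (2 * Real.pi * Complex.I : ℂ) • (1 : H →L[ℂ] H)‖ ≤
        2 * Real.pi * (‖X‖ * ε) := by
    intro ε hε
    have := (spectrum.resolvent_tendsto_cobounded (𝕜 := ℂ) X).norm
    rw [norm_zero] at this
    have h1 := this.eventually (gt_mem_nhds hε)
    obtain ⟨R0, hR0⟩ := (Filter.hasBasis_cobounded_norm.eventually_iff).1 h1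
    set R := max r R0
    have hR : r ≤ R := le_max_left _ _
    have hRpos : 0 < R := hr.trans_le hR
    rw [← hconst R hR, hsplit R hR, add_sub_cancel_left]
    refine (circleIntegral.norm_integral_le_of_norm_le_const (C := R⁻¹ * (‖X‖ * ε))
      hRpos.le fun z hz' => ?_).trans_eq (by field_simp)
    rw [mem_sphere_zero_iff_norm] at hz'
    rw [norm_smul, norm_inv, hz']
    refine mul_le_mul_of_nonneg_left ((norm_mul_le _ _).trans ?_) (by positivity)
    exact mul_le_mul_of_nonneg_left (hR0.2 (by
      simp only [Set.mem_ofPred_eq, hz']; exact le_max_right _ _) : _).le (norm_nonneg _)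
  refine sub_eq_zero.1 (norm_le_zero_iff.1 (le_of_forall_pos_le_add fun ε hε => ?_))
  rw [zero_add]
  -- The `+ 1` keeps the denominator positive when `X = 0`.
  refine (hlim (ε / (2 * Real.pi * (‖X‖ + 1))) (by positivity)).trans ?_
  rw [← mul_assoc, mul_div_assoc', div_le_iff₀ (by positivity)]
  have := Real.pi_pos
  nlinarith [norm_nonneg X, mul_pos this hε]

theorem holCalc_one (hδ : 0 < δ) (hδ1 : δ < 1) (hX : spectrum ℂ X ⊆ annulus δ) :
    holCalc δ (fun _ => 1) X = 1 := by
  obtain ⟨p, hp⟩ := exists_isContour hδ1 hX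
  have h1 := hp.1
  have h2 := hp.2.1
  rw [holCalc_eq hδ (differentiableOn_const _) hp, rieszDunford]
  simp only [one_smul]
  rw [circleIntegral_resolvent_of_spectrum_lt (by linarith) fun z hz => (hp.2.2.2 hz).2,
    circleIntegral_resolvent_of_lt_spectrum (by linarith) fun z hz => (hp.2.2.2 hz).1, sub_zero,
    smul_smul, inv_mul_cancel₀ Complex.two_pi_I_ne_zero, one_smul]

/-- An eigenvector of `X` is an eigenvector of `f(X)`. -/
theorem holCalc_apply_eigenvector (hδ : 0 < δ) (hδ1 : δ < 1) (hX : spectrum ℂ X ⊆ annulus δ)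
    {f : ℂ → ℂ} (hf : DifferentiableOn ℂ f (annulus δ)) {l : ℂ} (hl : l ∈ annulus δ) {x : H}
    (hx : X x = l • x) : holCalc δ f X x = f l • x := by
  -- Divide out the zero: `f = f l + (w - l) g` with `g` holomorphic, the value of `g` at `l` being
  -- the derivative.
  set g := dslope f l with hg
  have hgd : DifferentiableOn ℂ g (annulus δ) :=
    (Complex.differentiableOn_dslope ((isOpen_annulus δ).mem_nhds hl)).2 hf
  have hid : DifferentiableOn ℂ (fun w => w * g w) (annulus δ) := differentiableOn_id.mul hgd
  have hfg : ∀ w, f w = f l * 1 + (1 * (w * g w) + (-l) * g w) := by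
    intro w
    have := sub_smul_dslope f l w
    rw [smul_eq_mul, ← hg] at this
    linear_combination -this
  have e : holCalc δ f X = f l • 1 + (X * holCalc δ g X - l • holCalc δ g X) := by
    have h3 := holCalc_sum hδ hδ1 hX Finset.univ ![f l, 1, -l]
      (g := ![fun _ => 1, fun w => w * g w, g]) (fun i => by
        fin_cases i
        · exact differentiableOn_const _
        · exact hid
        · exact hgd)
    simp only [Fin.sum_univ_three, Matrix.cons_val_zero, Matrix.cons_val_one,
      Matrix.cons_val] at h3
    rw [holCalc_one hδ hδ1 hX, holCalc_id_mul hδ hδ1 hX hgd] at h3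
    rw [holCalc_congr hδ hδ1 hX hf (fun w _ => (hfg w).trans (add_assoc _ _ _).symm), h3]
    module
  -- After commuting, `X - l` acts on `x` first and kills it.
  rw [e, commute_holCalc hδ hδ1 hX hgd]
  simp [hx]

end Calculus

open scoped ComplexOrder MatrixOrder Matrix ComplexConjugate
open Matrix Filter Topology

/-! ### The cone of weighted positive matrices: closedness and duality. -/

section Weights

variable {ι : Type*} [Fintype ι]

/-- The matrix with entries `1 - conj (l i) * l j`. -/
def szegoWeight {ι : Type*} (l : ι → ℂ) : Matrix ι ι ℂ := of fun i j => 1 - conj (l i) * l j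

theorem isHermitian_szegoWeight {ι : Type*} (l : ι → ℂ) : (szegoWeight l).IsHermitian := by
  ext i j
  simp [szegoWeight, mul_comm]

/-- Positivity of the weighted product thus says that multiplication by `l` is contractive for the
form of `H`. -/
theorem dotProduct_szegoWeight_hadamard (l : ι → ℂ) (H : Matrix ι ι ℂ) (a : ι → ℂ) :
    star a ⬝ᵥ ((szegoWeight l ⊙ H) *ᵥ a) =
      star a ⬝ᵥ (H *ᵥ a) - star (l * a) ⬝ᵥ (H *ᵥ (l * a)) := by
  simp only [dotProduct, mulVec, Finset.mul_sum, ← Finset.sum_sub_distrib]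
  refine Finset.sum_congr rfl fun i _ => Finset.sum_congr rfl fun j _ => ?_
  simp only [szegoWeight, hadamard_apply, of_apply, Pi.star_apply, Pi.mul_apply, star_mul',
    RCLike.star_def]
  ring

/-- Along the orbit `l ^ k * a` the form of `H` decreases, while the orbit tends to `0`; so the form
is at least its limit `0` at `a`. -/
theorem posSemidef_of_szegoWeight_hadamard {l : ι → ℂ} (hl : ∀ i, ‖l i‖ < 1) {H : Matrix ι ι ℂ}
    (hH : H.IsHermitian) (h : (szegoWeight l ⊙ H).PosSemidef) : H.PosSemidef := by
  refine .of_dotProduct_mulVec_nonneg hH fun a => ?_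
  have hstep : ∀ k : ℕ, star (l ^ k * a) ⬝ᵥ (H *ᵥ (l ^ k * a)) ≤ star a ⬝ᵥ (H *ᵥ a) := by
    intro k
    induction k with
    | zero => simp
    | succ k ih =>
      refine le_trans ?_ ih
      have := h.dotProduct_mulVec_nonneg (l ^ k * a)
      rw [dotProduct_szegoWeight_hadamard, sub_nonneg] at this
      rwa [pow_succ', mul_assoc]
  have hlim : Tendsto (fun k : ℕ => l ^ k * a) atTop (𝓝 0) := by
    rw [tendsto_pi_nhds]
    intro i
    simpa using (tendsto_pow_atTop_nhds_zero_of_norm_lt_one (hl i)).mul_const (a i)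
  have hcont : Continuous fun b : ι → ℂ => star b ⬝ᵥ (H *ᵥ b) := by
    unfold dotProduct mulVec dotProduct
    fun_prop
  have := (hcont.tendsto 0).comp hlim
  simp only [star_zero, mulVec_zero, dotProduct_zero] at this
  exact le_of_tendsto this (Eventually.of_forall hstep)

theorem isClosed_posSemidef : IsClosed {A : Matrix ι ι ℂ | A.PosSemidef} := by
  have : {A : Matrix ι ι ℂ | A.PosSemidef} =
      {A | Aᴴ = A} ∩ ⋂ x : ι → ℂ, {A | 0 ≤ star x ⬝ᵥ (A *ᵥ x)} := by
    ext A
    simp [posSemidef_iff_dotProduct_mulVec, IsHermitian]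
  rw [this]
  refine (isClosed_eq (by fun_prop) continuous_id).inter (isClosed_iInter fun x => ?_)
  refine isClosed_le continuous_const ?_
  unfold dotProduct mulVec dotProduct
  fun_prop

attribute [local instance] Matrix.normedAddCommGroup Matrix.normedSpace

/-- The norm is the entrywise supremum. A positive matrix is a Gram matrix, so Cauchy–Schwarz bounds
every entry by the diagonal. -/
theorem PosSemidef.norm_le_of_diag_le {A : Matrix ι ι ℂ} (hA : A.PosSemidef) {c : ℝ}
    (hc : 0 ≤ c) (h : ∀ i, (A i i).re ≤ c) : ‖A‖ ≤ c := by
  classical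
  rw [Matrix.norm_le_iff hc]
  intro i j
  obtain ⟨B, rfl⟩ := CStarAlgebra.nonneg_iff_eq_star_mul_self.mp hA.nonneg
  have hB : ∀ i j, (star B * B) i j =
      ⟪WithLp.toLp 2 (fun k => B k i), (WithLp.toLp 2 (fun k => B k j) : EuclideanSpace ℂ ι)⟫_ℂ := by
    intro i j
    simp [Matrix.mul_apply, PiLp.inner_apply, mul_comm]
  have hn : ∀ i, ‖(WithLp.toLp 2 (fun k => B k i) : EuclideanSpace ℂ ι)‖ ^ 2 ≤ c := by
    intro i
    have := h i
    rw [hB, inner_self_eq_norm_sq_to_K] at this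
    norm_cast at this
  rw [hB]
  refine (norm_inner_le_norm _ _).trans ?_
  nlinarith [hn i, hn j, sq_nonneg (‖(WithLp.toLp 2 (fun k => B k i) : EuclideanSpace ℂ ι)‖ -
    ‖(WithLp.toLp 2 (fun k => B k j) : EuclideanSpace ℂ ι)‖)]

/-- The cone of all sums `szegoWeight l ⊙ A + szegoWeight m ⊙ B` with `A`, `B` positive. -/
def pickCone {ι : Type*} (l m : ι → ℂ) : Set (Matrix ι ι ℂ) :=
  {T | ∃ A B : Matrix ι ι ℂ, A.PosSemidef ∧ B.PosSemidef ∧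
    T = szegoWeight l ⊙ A + szegoWeight m ⊙ B}

theorem exists_diag_bound {l : ι → ℂ} (hl : ∀ i, ‖l i‖ < 1) :
    ∃ c : ℝ, 0 ≤ c ∧ ∀ (i : ι) (x : ℂ), 0 ≤ x →
      x.re ≤ c * ((szegoWeight l i i) * x).re ∧ 0 ≤ ((szegoWeight l i i) * x).re := by
  have hw : ∀ i, szegoWeight l i i = ((1 - ‖l i‖ ^ 2 : ℝ) : ℂ) := by
    intro i
    simp [szegoWeight, Complex.conj_mul']
  have hpos : ∀ i, 0 < 1 - ‖l i‖ ^ 2 := fun i => by nlinarith [hl i, norm_nonneg (l i)]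
  refine ⟨∑ i, (1 - ‖l i‖ ^ 2)⁻¹, Finset.sum_nonneg fun i _ => inv_nonneg.2 (hpos i).le,
    fun i x hx => ?_⟩
  have hx' : 0 ≤ x.re := (Complex.nonneg_iff.1 hx).1
  rw [hw, Complex.re_ofReal_mul]
  refine ⟨?_, mul_nonneg (hpos i).le hx'⟩
  have h1 : (1 - ‖l i‖ ^ 2)⁻¹ ≤ ∑ i, (1 - ‖l i‖ ^ 2)⁻¹ :=
    Finset.single_le_sum (f := fun i => (1 - ‖l i‖ ^ 2)⁻¹)
      (fun i _ => inv_nonneg.2 (hpos i).le) (Finset.mem_univ i)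
  calc x.re = (1 - ‖l i‖ ^ 2)⁻¹ * ((1 - ‖l i‖ ^ 2) * x.re) := by
        rw [inv_mul_cancel_left₀ (hpos i).ne']
    _ ≤ _ := mul_le_mul_of_nonneg_right h1 (mul_nonneg (hpos i).le hx')

/-- On the diagonal both weights are positive, so neither summand can be cancelled by the other, and
a bound on the sum bounds `A` and `B`. Near any point the cone is therefore the continuous image of
a compact set of pairs. -/
theorem isClosed_pickCone {l m : ι → ℂ} (hl : ∀ i, ‖l i‖ < 1) (hm : ∀ i, ‖m i‖ < 1) :
    IsClosed (pickCone l m) := by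
  obtain ⟨c, hc, hc'⟩ := exists_diag_bound hl
  obtain ⟨d, hd, hd'⟩ := exists_diag_bound hm
  set F : Matrix ι ι ℂ × Matrix ι ι ℂ → Matrix ι ι ℂ :=
    fun p => szegoWeight l ⊙ p.1 + szegoWeight m ⊙ p.2 with hF
  have hFc : Continuous F := by
    refine continuous_matrix fun i j => ?_
    simp only [hF, Matrix.add_apply, hadamard_apply]
    fun_prop
  have hbound : ∀ A B : Matrix ι ι ℂ, A.PosSemidef → B.PosSemidef →
      ‖A‖ ≤ c * ‖F (A, B)‖ ∧ ‖B‖ ≤ d * ‖F (A, B)‖ := by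
    intro A B hA hB
    have h : ∀ i, (szegoWeight l i i * A i i).re + (szegoWeight m i i * B i i).re ≤ ‖F (A, B)‖ := by
      intro i
      rw [← Complex.add_re]
      refine (Complex.re_le_norm _).trans ?_
      exact Matrix.norm_entry_le_entrywise_sup_norm (F (A, B)) (i := i) (j := i)
    refine ⟨PosSemidef.norm_le_of_diag_le hA (by positivity) fun i => ?_,
      PosSemidef.norm_le_of_diag_le hB (by positivity) fun i => ?_⟩
    · refine (hc' i _ hA.diag_nonneg).1.trans (mul_le_mul_of_nonneg_left ?_ hc)
      linarith [h i, (hd' i _ (hB.diag_nonneg (i := i))).2]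
    · refine (hd' i _ hB.diag_nonneg).1.trans (mul_le_mul_of_nonneg_left ?_ hd)
      linarith [h i, (hc' i _ (hA.diag_nonneg (i := i))).2]
  refine isClosed_of_closure_subset fun T hT => ?_
  set K : Set (Matrix ι ι ℂ × Matrix ι ι ℂ) :=
    ({A | A.PosSemidef} ∩ Metric.closedBall 0 (c * (‖T‖ + 1))) ×ˢ
      ({A | A.PosSemidef} ∩ Metric.closedBall 0 (d * (‖T‖ + 1))) with hK
  have hKc : IsCompact K :=
    ((isCompact_closedBall _ _).inter_left isClosed_posSemidef).prod
      ((isCompact_closedBall _ _).inter_left isClosed_posSemidef)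
  have hTK : T ∈ closure (F '' K) := by
    refine Metric.mem_closure_iff.2 fun ε hε => ?_
    replace hT := Metric.mem_closure_iff.1 hT
    obtain ⟨S, ⟨A, B, hA, hB, rfl⟩, hS⟩ := hT (min ε 1) (by positivity)
    have hS1 := hS.trans_le (min_le_right _ _)
    have hn : ‖F (A, B)‖ ≤ ‖T‖ + 1 := by
      have := norm_sub_norm_le (F (A, B)) T
      rw [← dist_eq_norm, dist_comm] at this
      linarith
    refine ⟨F (A, B), ⟨(A, B), ⟨⟨hA, ?_⟩, ⟨hB, ?_⟩⟩, rfl⟩, hS.trans_le (min_le_left _ _)⟩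
    · rw [mem_closedBall_zero_iff]
      exact (hbound A B hA hB).1.trans (mul_le_mul_of_nonneg_left hn hc)
    · rw [mem_closedBall_zero_iff]
      exact (hbound A B hA hB).2.trans (mul_le_mul_of_nonneg_left hn hd)
  rw [(hKc.image hFc).isClosed.closure_eq] at hTK
  obtain ⟨⟨A, B⟩, h, rfl⟩ := hTK
  exact ⟨A, B, h.1.1, h.2.1, rfl⟩

omit [Fintype ι] in
theorem convex_pickCone (l m : ι → ℂ) : Convex ℝ (pickCone l m) := by
  rintro _ ⟨A, B, hA, hB, rfl⟩ _ ⟨A', B', hA', hB', rfl⟩ s t hs ht -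
  refine ⟨s • A + t • A', s • B + t • B', (hA.smul hs).add (hA'.smul ht),
    (hB.smul hs).add (hB'.smul ht), ?_⟩
  simp only [hadamard_add, hadamard_smul, smul_add]
  abel

/-- A Hermitian matrix outside the Pick cone is separated from it by a Hermitian matrix. -/
theorem exists_separating_matrix {l m : ι → ℂ} (hl : ∀ i, ‖l i‖ < 1) (hm : ∀ i, ‖m i‖ < 1)
    {P : Matrix ι ι ℂ} (hP : P.IsHermitian) (hPC : P ∉ pickCone l m) :
    ∃ H : Matrix ι ι ℂ, H.IsHermitian ∧ (szegoWeight l ⊙ H).PosSemidef ∧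
      (szegoWeight m ⊙ H).PosSemidef ∧ (∑ i, ∑ j, P i j * H i j).re < 0 := by
  classical
  have : LocallyConvexSpace ℝ (Matrix ι ι ℂ) :=
    inferInstanceAs (LocallyConvexSpace ℝ (ι → ι → ℂ))
  obtain ⟨f, u, hf, hu⟩ := RCLike.geometric_hahn_banach_closed_point (𝕜 := ℂ)
    (convex_pickCone l m) (isClosed_pickCone hl hm) hPC
  simp only [RCLike.re_to_complex] at hf hu
  have hsmul : ∀ (s : ℝ), 0 ≤ s → ∀ T ∈ pickCone l m, s • T ∈ pickCone l m := by
    rintro s hs _ ⟨A, B, hA, hB, rfl⟩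
    exact ⟨s • A, s • B, hA.smul hs, hB.smul hs, by simp [hadamard_smul]⟩
  have hzero : (0 : Matrix ι ι ℂ) ∈ pickCone l m := ⟨0, 0, .zero, .zero, by simp⟩
  have hu0 : 0 < u := by simpa using hf 0 hzero
  have hneg : ∀ T ∈ pickCone l m, (f T).re ≤ 0 := by
    intro T hT
    by_contra! hpos
    -- Rescaled so that the functional takes exactly the value `u`, the point violates the strict
    -- bound on the cone.
    have := hf _ (hsmul (u / (f T).re) (by positivity) T hT)
    rw [map_real_smul f f.continuous] at this
    rw [Complex.smul_re, smul_eq_mul, div_mul_cancel₀ _ hpos.ne'] at this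
    exact lt_irrefl _ this
  set c : Matrix ι ι ℂ := of fun i j => f (single i j 1) with hc
  have hfc : ∀ T, f T = ∑ i, ∑ j, T i j * c i j := by
    intro T
    conv_lhs => rw [matrix_eq_sum_single T]
    simp only [map_sum, hc, of_apply]
    refine Finset.sum_congr rfl fun i _ => Finset.sum_congr rfl fun j _ => ?_
    rw [← smul_eq_mul, ← map_smul, smul_single, smul_eq_mul, mul_one]
  -- Minus the Hermitian part of the coefficient matrix: pairing a Hermitian `T` with it gives `-Re
  -- (f T)`.
  set H : Matrix ι ι ℂ := (-(1 / 2 : ℂ)) • (c + cᴴ) with hH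
  have hHh : H.IsHermitian := by
    rw [hH, IsHermitian, conjTranspose_smul, conjTranspose_add, conjTranspose_conjTranspose,
      add_comm]
    simp
  have hHf : ∀ T : Matrix ι ι ℂ, T.IsHermitian → (∑ i, ∑ j, T i j * H i j) = -((f T).re : ℂ) := by
    intro T hT
    have h1 : (∑ i, ∑ j, T i j * cᴴ i j) = conj (f T) := by
      rw [hfc, map_sum, Finset.sum_comm]
      refine Finset.sum_congr rfl fun i _ => ?_
      rw [map_sum]
      refine Finset.sum_congr rfl fun j _ => ?_
      rw [map_mul, conjTranspose_apply, ← hT.apply]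
      simp
    have h2 : (∑ i, ∑ j, T i j * H i j) =
        -(1 / 2 : ℂ) * ((∑ i, ∑ j, T i j * c i j) + ∑ i, ∑ j, T i j * cᴴ i j) := by
      simp only [← Finset.sum_add_distrib, Finset.mul_sum]
      refine Finset.sum_congr rfl fun i _ => Finset.sum_congr rfl fun j _ => ?_
      simp only [hH, Matrix.smul_apply, Matrix.add_apply, smul_eq_mul]
      ring
    rw [h2, h1, ← hfc, Complex.add_conj]
    push_cast
    ring
  -- The quadratic form at `a` is the pairing of `H` with a weighted rank-one matrix, so only
  -- rank-one elements of the cone are needed.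
  have hquad : ∀ k : ι → ℂ, (∀ a : ι → ℂ,
      szegoWeight k ⊙ vecMulVec (star a) a ∈ pickCone l m) → (szegoWeight k ⊙ H).PosSemidef := by
    intro k hk
    refine .of_dotProduct_mulVec_nonneg
      ((isHermitian_szegoWeight k).hadamard hHh) fun a => ?_
    have h1 : star a ⬝ᵥ ((szegoWeight k ⊙ H) *ᵥ a) =
        ∑ i, ∑ j, (szegoWeight k ⊙ vecMulVec (star a) a) i j * H i j := by
      simp only [dotProduct, mulVec, Finset.mul_sum, hadamard_apply, vecMulVec_apply]
      refine Finset.sum_congr rfl fun i _ => Finset.sum_congr rfl fun j _ => ?_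
      ring
    rw [h1, hHf _ ((isHermitian_szegoWeight k).hadamard
      (posSemidef_vecMulVec_star_self a).isHermitian)]
    have := hneg _ (hk a)
    rw [← Complex.ofReal_neg]
    exact_mod_cast neg_nonneg.2 this
  refine ⟨H, hHh, hquad l fun a => ?_, hquad m fun a => ?_, ?_⟩
  · exact ⟨_, 0, posSemidef_vecMulVec_star_self a, .zero, by simp⟩
  · exact ⟨0, _, .zero, posSemidef_vecMulVec_star_self a, by simp⟩
  · rw [hHf P hP, ← Complex.ofReal_neg, Complex.ofReal_re]
    linarith

end Weights

/-! ### Test operators with prescribed eigenvalues and Gram matrix of eigenvectors. -/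

theorem norm_holCalc_le_one {δ : ℝ} {f : ℂ → ℂ} (hf : f ∈ dpSchur.{v} δ) {H : Type v}
    [NormedAddCommGroup H] [InnerProductSpace ℂ H] [CompleteSpace H] {X : H →L[ℂ] H}
    (hX : IsDPFamily δ X) : ‖holCalc δ f X‖ ≤ 1 := by
  have h := hf.2
  simp only [dpNorm, iSup_le_iff] at h
  exact ENNReal.ofReal_le_one.1 (h H _ _ _ X hX)

theorem norm_div_lt_one {δ : ℝ} (hδ : 0 < δ) {w : ℂ} (hw : w ∈ annulus δ) :
    ‖(δ : ℂ) / w‖ < 1 := by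
  rw [norm_div, Complex.norm_real, Real.norm_of_nonneg hδ.le, div_lt_one (hδ.trans hw.1)]
  exact hw.1

theorem ne_zero_of_mem_annulus {δ : ℝ} (hδ : 0 < δ) {w : ℂ} (hw : w ∈ annulus δ) : w ≠ 0 := by
  rintro rfl
  have := hw.1
  rw [norm_zero] at this
  linarith

theorem norm_sq_toLp_mulVec {ι κ : Type*} [Fintype ι] [Fintype κ] (B : Matrix κ ι ℂ) (a : ι → ℂ) :
    ((‖(WithLp.toLp 2 (B *ᵥ a) : EuclideanSpace ℂ κ)‖ ^ 2 : ℝ) : ℂ) =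
      star a ⬝ᵥ ((Bᴴ * B) *ᵥ a) := by
  rw [← mulVec_mulVec, dotProduct_mulVec, ← star_mulVec, EuclideanSpace.norm_sq_eq]
  simp [dotProduct, Complex.conj_mul']

section DiagonalOperator

variable {ι : Type*} [Fintype ι] [DecidableEq ι]

/-- The operators that are diagonal in the basis given by the columns of `B`. -/
def diagOp (B : (Matrix ι ι ℂ)ˣ) :
    (ι → ℂ) →ₐ[ℂ] (EuclideanSpace ℂ ι →L[ℂ] EuclideanSpace ℂ ι) where
  toFun d := toEuclideanCLM (𝕜 := ℂ) ((B : Matrix ι ι ℂ) * diagonal d * (B⁻¹ : (Matrix ι ι ℂ)ˣ))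
  map_one' := by simp
  map_mul' c d := by
    have h : diagonal (c * d) = diagonal c * diagonal d := (diagonal_mul_diagonal c d).symm
    rw [← map_mul, h]
    congr 1
    simp only [mul_assoc, Units.inv_mul_cancel_left]
  map_zero' := by simp
  map_add' c d := by
    have h : diagonal (c + d) = diagonal c + diagonal d := (diagonal_add c d).symm
    rw [← map_add, h, mul_add, add_mul]
  commutes' r := by
    have : diagonal (algebraMap ℂ (ι → ℂ) r) = r • (1 : Matrix ι ι ℂ) := by
      rw [smul_one_eq_diagonal]; rfl
    rw [this, mul_smul_comm, mul_one, smul_mul_assoc, Units.mul_inv, map_smul, map_one,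
      Algebra.algebraMap_eq_smul_one]

theorem diagOp_eq (B : (Matrix ι ι ℂ)ˣ) (d : ι → ℂ) :
    diagOp B d = toEuclideanCLM (𝕜 := ℂ) ((B : Matrix ι ι ℂ) * diagonal d *
      ((B⁻¹ : (Matrix ι ι ℂ)ˣ) : Matrix ι ι ℂ)) := rfl

theorem diagOp_apply (B : (Matrix ι ι ℂ)ˣ) (d a : ι → ℂ) :
    diagOp B d (WithLp.toLp 2 ((B : Matrix ι ι ℂ) *ᵥ a)) =
      WithLp.toLp 2 ((B : Matrix ι ι ℂ) *ᵥ (d * a)) := by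
  rw [diagOp_eq, toEuclideanCLM_toLp, mulVec_mulVec, mul_assoc, Units.inv_mul, mul_one, ← mulVec_mulVec]
  congr 2
  ext i
  simp [mulVec_diagonal]

theorem exists_eq_toLp_mulVec (B : (Matrix ι ι ℂ)ˣ) (x : EuclideanSpace ℂ ι) :
    ∃ a, x = WithLp.toLp 2 ((B : Matrix ι ι ℂ) *ᵥ a) :=
  ⟨((B⁻¹ : (Matrix ι ι ℂ)ˣ) : Matrix ι ι ℂ) *ᵥ x.ofLp, by simp⟩

/-- In eigenvector coordinates the squared norm is the form of the Gram matrix `Bᴴ * B`, and the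
operator multiplies coordinates by `d`. -/
theorem norm_diagOp_le_one (B : (Matrix ι ι ℂ)ˣ) (d : ι → ℂ)
    (h : (szegoWeight d ⊙ ((B : Matrix ι ι ℂ)ᴴ * B)).PosSemidef) : ‖diagOp B d‖ ≤ 1 := by
  refine ContinuousLinearMap.opNorm_le_bound _ zero_le_one fun x => ?_
  obtain ⟨a, rfl⟩ := exists_eq_toLp_mulVec B x
  rw [one_mul, diagOp_apply]
  refine le_of_sq_le_sq ?_ (norm_nonneg _)
  have := h.dotProduct_mulVec_nonneg a
  rw [dotProduct_szegoWeight_hadamard, sub_nonneg, ← norm_sq_toLp_mulVec,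
    ← norm_sq_toLp_mulVec] at this
  exact_mod_cast this

theorem spectrum_diagOp_subset (B : (Matrix ι ι ℂ)ˣ) (d : ι → ℂ) :
    spectrum ℂ (diagOp B d) ⊆ Set.range d := by
  refine (AlgHom.spectrum_apply_subset (diagOp B) d).trans fun z hz => ?_
  by_contra hne
  refine hz (spectrum.mem_resolventSet_iff.2 (Pi.isUnit_iff.2 fun i => ?_))
  refine isUnit_iff_ne_zero.2 (sub_ne_zero.2 fun h => hne ⟨i, ?_⟩)
  exact h.symm

theorem isDPFamily_diagOp {δ : ℝ} (hδ : 0 < δ) (B : (Matrix ι ι ℂ)ˣ) {l : ι → ℂ}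
    (hl : ∀ i, l i ∈ annulus δ) (h1 : (szegoWeight l ⊙ ((B : Matrix ι ι ℂ)ᴴ * B)).PosSemidef)
    (h2 : (szegoWeight (fun i => δ / l i) ⊙ ((B : Matrix ι ι ℂ)ᴴ * B)).PosSemidef) :
    IsDPFamily δ (diagOp B l) := by
  have hne : ∀ i, l i ≠ 0 := fun i => ne_zero_of_mem_annulus hδ (hl i)
  have hlinv : l * l⁻¹ = 1 := funext fun i => mul_inv_cancel₀ (hne i)
  have hinv1 : diagOp B l * diagOp B l⁻¹ = 1 := by rw [← map_mul, hlinv, map_one]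
  have hinv2 : diagOp B l⁻¹ * diagOp B l = 1 := by rw [← map_mul, mul_comm, hlinv, map_one]
  refine ⟨⟨⟨⟨_, _, hinv1, hinv2⟩, rfl⟩, norm_diagOp_le_one B l h1, ?_⟩,
    (spectrum_diagOp_subset B l).trans (Set.range_subset_iff.2 hl)⟩
  have e : Ring.inverse (diagOp B l) = diagOp B l⁻¹ :=
    Ring.inverse_unit ⟨diagOp B l, diagOp B l⁻¹, hinv1, hinv2⟩
  have e2 : diagOp B (fun i => δ / l i) = (δ : ℂ) • diagOp B l⁻¹ := by
    rw [← map_smul]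
    congr 1
  have := norm_diagOp_le_one B _ h2
  rw [e2, norm_smul, Complex.norm_real, Real.norm_of_nonneg hδ.le] at this
  rw [e, le_div_iff₀ hδ, mul_comm]
  exact this

theorem holCalc_diagOp {δ : ℝ} (hδ : 0 < δ) (hδ1 : δ < 1) (B : (Matrix ι ι ℂ)ˣ) {l : ι → ℂ}
    (hl : ∀ i, l i ∈ annulus δ) {f : ℂ → ℂ} (hf : DifferentiableOn ℂ f (annulus δ)) :
    holCalc δ f (diagOp B l) = diagOp B (f ∘ l) := by
  have hsp : spectrum ℂ (diagOp B l) ⊆ annulus δ :=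
    (spectrum_diagOp_subset B l).trans (Set.range_subset_iff.2 hl)
  have heig : ∀ (d : ι → ℂ) (i : ι), diagOp B d (WithLp.toLp 2 ((B : Matrix ι ι ℂ) *ᵥ
      Pi.single i 1)) = d i • WithLp.toLp 2 ((B : Matrix ι ι ℂ) *ᵥ Pi.single i 1) := by
    intro d i
    rw [diagOp_apply, ← WithLp.toLp_smul, ← mulVec_smul]
    congr 2
    ext j
    rcases eq_or_ne j i with rfl | hji
    · simp
    · simp [hji]
  ext1 x
  obtain ⟨a, rfl⟩ := exists_eq_toLp_mulVec B x
  have ha : (WithLp.toLp 2 ((B : Matrix ι ι ℂ) *ᵥ a) : EuclideanSpace ℂ ι) =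
      ∑ i, a i • WithLp.toLp 2 ((B : Matrix ι ι ℂ) *ᵥ Pi.single i 1) := by
    simp_rw [← WithLp.toLp_smul, ← mulVec_smul, ← WithLp.toLp_sum, ← mulVec_sum]
    congr 2
    ext j
    simp [Pi.single_apply]
  rw [ha, map_sum, map_sum]
  refine Finset.sum_congr rfl fun i _ => ?_
  rw [map_smul, map_smul, heig, holCalc_apply_eigenvector hδ hδ1 hsp hf (hl i) (heig l i)]
  rfl

end DiagonalOperator

/-- The Pick matrix of a solvable problem lies in the Pick cone. -/
theorem szegoWeight_mem_pickCone {δ : ℝ} (hδ : 0 < δ) (hδ1 : δ < 1) {ι : Type v} [Fintype ι]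
    {l : ι → ℂ} (hl : ∀ i, l i ∈ annulus δ) {f : ℂ → ℂ} (hf : f ∈ dpSchur.{v} δ) :
    szegoWeight (f ∘ l) ∈ pickCone l (fun i => δ / l i) := by
  classical
  by_contra hP
  have hl1 : ∀ i, ‖l i‖ < 1 := fun i => (hl i).2
  have hl2 : ∀ i, ‖(δ : ℂ) / l i‖ < 1 := fun i => norm_div_lt_one hδ (hl i)
  obtain ⟨H, hH, h1, h2, h3⟩ :=
    exists_separating_matrix hl1 hl2 (isHermitian_szegoWeight (f ∘ l)) hP
  have hsum : ∀ K : Matrix ι ι ℂ, star (1 : ι → ℂ) ⬝ᵥ ((szegoWeight (f ∘ l) ⊙ K) *ᵥ 1) =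
      ∑ i, ∑ j, szegoWeight (f ∘ l) i j * K i j := by
    intro K
    simp [dotProduct, mulVec]
  have hone : ∀ {k : ι → ℂ}, (∀ i, ‖k i‖ < 1) → (szegoWeight k ⊙ (1 : Matrix ι ι ℂ)).PosSemidef := by
    intro k hk
    have : szegoWeight k ⊙ (1 : Matrix ι ι ℂ) =
        diagonal fun i => ((1 - ‖k i‖ ^ 2 : ℝ) : ℂ) := by
      ext i j
      rcases eq_or_ne i j with rfl | hij
      · simp [szegoWeight, Complex.conj_mul']
      · simp [hij]
    rw [this]
    refine .diagonal fun i => ?_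
    have : 0 ≤ 1 - ‖k i‖ ^ 2 := by nlinarith [hk i, norm_nonneg (k i)]
    exact Complex.zero_le_real.2 this
  -- `H` may be singular; adding `ε` makes it positive definite, hence the Gram matrix of a genuine
  -- basis, and preserves both weighted positivity conditions. The form at the all-ones vector is
  -- the separating pairing, and it survives the limit `ε → 0`.
  have hε : ∀ ε : ℝ, 0 < ε →
      0 ≤ star (1 : ι → ℂ) ⬝ᵥ ((szegoWeight (f ∘ l) ⊙ (H + ε • 1)) *ᵥ 1) := by
    intro ε hε
    have hK : ∀ {k : ι → ℂ}, (∀ i, ‖k i‖ < 1) → (szegoWeight k ⊙ H).PosSemidef →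
        (szegoWeight k ⊙ (H + ε • 1)).PosSemidef := by
      intro k hk h
      rw [hadamard_add, hadamard_smul]
      exact h.add ((hone hk).smul hε.le)
    have hpd : (H + ε • 1).PosDef :=
      PosDef.posSemidef_add (posSemidef_of_szegoWeight_hadamard hl1 hH h1) (PosDef.one.smul hε)
    obtain ⟨B, hB⟩ := CStarAlgebra.nonneg_iff_eq_star_mul_self.mp hpd.posSemidef.nonneg
    rw [star_eq_conjTranspose] at hB
    have hBu : IsUnit B := by
      have := hpd.isUnit
      rw [hB] at this
      exact isUnit_of_mul_isUnit_right this
    obtain ⟨U, rfl⟩ := hBu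
    have hk1 := hK hl1 h1
    have hk2 := hK hl2 h2
    rw [hB] at hk1 hk2 ⊢
    have hn := norm_holCalc_le_one hf (isDPFamily_diagOp hδ U hl hk1 hk2)
    rw [holCalc_diagOp hδ hδ1 U hl hf.1] at hn
    have h4 := (diagOp U (f ∘ l)).le_of_opNorm_le hn (WithLp.toLp 2 ((U : Matrix ι ι ℂ) *ᵥ 1))
    rw [one_mul, diagOp_apply] at h4
    have h5 := pow_le_pow_left₀ (norm_nonneg _) h4 2
    rw [dotProduct_szegoWeight_hadamard, sub_nonneg, ← norm_sq_toLp_mulVec,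
      ← norm_sq_toLp_mulVec]
    exact_mod_cast h5
  have hlim : Tendsto (fun ε : ℝ => star (1 : ι → ℂ) ⬝ᵥ
      ((szegoWeight (f ∘ l) ⊙ (H + ε • 1)) *ᵥ 1)) (𝓝[>] 0)
      (𝓝 (star (1 : ι → ℂ) ⬝ᵥ ((szegoWeight (f ∘ l) ⊙ (H + (0 : ℝ) • 1)) *ᵥ 1))) := by
    refine (Continuous.tendsto ?_ 0).mono_left nhdsWithin_le_nhds
    simp only [hsum, Matrix.add_apply, Matrix.smul_apply]
    fun_prop
  have := ge_of_tendsto hlim (eventually_mem_nhdsWithin.mono hε)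
  rw [hsum, zero_smul, add_zero] at this
  exact h3.not_ge (Complex.nonneg_iff.1 this).1

/-! ### Lurking isometries. -/

section Isometry

variable {ι κ : Type*} [Fintype ι] [Fintype κ]

/-- The lurking isometry argument: vectors with equal Gram matrices differ by an isometry. -/
theorem exists_isometry_mul_eq [DecidableEq κ] {P Q : Matrix κ ι ℂ} (h : Pᴴ * P = Qᴴ * Q) :
    ∃ V : Matrix κ κ ℂ, Vᴴ * V = 1 ∧ V * P = Q := by
  classical
  let lp : (κ → ℂ) ≃ₗ[ℂ] EuclideanSpace ℂ κ := (WithLp.linearEquiv 2 ℂ (κ → ℂ)).symm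
  let p : (ι → ℂ) →ₗ[ℂ] EuclideanSpace ℂ κ := lp.toLinearMap ∘ₗ P.mulVecLin
  let q : (ι → ℂ) →ₗ[ℂ] EuclideanSpace ℂ κ := lp.toLinearMap ∘ₗ Q.mulVecLin
  have hnorm : ∀ c, ‖q c‖ = ‖p c‖ := by
    intro c
    have h1 := norm_sq_toLp_mulVec P c
    rw [h, ← norm_sq_toLp_mulVec Q c] at h1
    exact ((sq_eq_sq₀ (norm_nonneg _) (norm_nonneg _)).1 (by exact_mod_cast h1)).symm
  obtain ⟨g, hg⟩ := p.rangeRestrict.exists_rightInverse_of_surjective p.range_rangeRestrict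
  have hg' : ∀ s, p (g s) = s := fun s => congrArg Subtype.val (LinearMap.congr_fun hg s)
  -- The map `p c ↦ q c`, defined through a linear section `g` of `p`. Equality of norms makes it
  -- isometric and, applied to differences, independent of the section. In finite dimension it
  -- extends to the whole space.
  let L : LinearMap.range p →ₗᵢ[ℂ] EuclideanSpace ℂ κ :=
    ⟨q ∘ₗ g, fun s => by rw [LinearMap.comp_apply, hnorm, hg', Submodule.coe_norm]⟩
  have hL : ∀ c, L.extend (p c) = q c := by
    intro c
    have h1 : L.extend (p c) = L ⟨p c, LinearMap.mem_range_self p c⟩ :=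
      L.extend_apply ⟨p c, LinearMap.mem_range_self p c⟩
    rw [h1]
    change q (g _) = q c
    rw [← sub_eq_zero, ← map_sub, ← norm_eq_zero, hnorm, map_sub, hg', sub_self, norm_zero]
  let T : EuclideanSpace ℂ κ →L[ℂ] EuclideanSpace ℂ κ := L.extend.toContinuousLinearMap
  have hT : star T * T = 1 := (ContinuousLinearMap.norm_map_iff_adjoint_comp_self T).1
    fun x => L.extend.norm_map x
  let Φ := toEuclideanCLM (n := κ) (𝕜 := ℂ)
  obtain ⟨V, hV⟩ : ∃ V, Φ V = T := ⟨Φ.symm T, Φ.apply_symm_apply T⟩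
  refine ⟨V, EquivLike.injective Φ ?_, Matrix.ext_of_mulVec_single fun j => ?_⟩
  · rw [map_mul, map_one, ← star_eq_conjTranspose, map_star, hV, hT]
  · rw [← mulVec_mulVec]
    have h1 : Φ V (WithLp.toLp 2 (P *ᵥ Pi.single j 1)) =
        WithLp.toLp 2 (Q *ᵥ Pi.single j 1) := by
      rw [hV]
      exact hL (Pi.single j 1)
    exact congrArg WithLp.ofLp h1

variable {H : Type*} [NormedAddCommGroup H] [InnerProductSpace ℂ H]

theorem sum_inner_isometry [DecidableEq κ] {V : Matrix κ κ ℂ} (hV : Vᴴ * V = 1) (x y : κ → H) :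
    ∑ i, ⟪∑ j, V i j • x j, ∑ j, V i j • y j⟫_ℂ = ∑ j, ⟪x j, y j⟫_ℂ := by
  have h1 : ∀ i, ⟪∑ j, V i j • x j, ∑ j, V i j • y j⟫_ℂ =
      ∑ j, ∑ k, (Vᴴ j i * V i k) * ⟪x j, y k⟫_ℂ := by
    intro i
    rw [sum_inner]
    refine Finset.sum_congr rfl fun j _ => ?_
    rw [inner_sum]
    refine Finset.sum_congr rfl fun k _ => ?_
    rw [inner_smul_left, inner_smul_right, conjTranspose_apply, RCLike.star_def, mul_assoc]
  simp_rw [h1]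
  rw [Finset.sum_comm]
  refine Finset.sum_congr rfl fun j _ => ?_
  rw [Finset.sum_comm]
  simp_rw [← Finset.sum_mul, ← Matrix.mul_apply, hV, Matrix.one_apply]
  simp

theorem sum_norm_sq_isometry [DecidableEq κ] {V : Matrix κ κ ℂ} (hV : Vᴴ * V = 1) (x : κ → H) :
    ∑ i, ‖∑ j, V i j • x j‖ ^ 2 = ∑ j, ‖x j‖ ^ 2 := by
  have := sum_inner_isometry hV x x
  simp only [inner_self_eq_norm_sq_to_K] at this
  exact_mod_cast this

end Isometry

/-! ### Closure properties of rational functions without poles on a set. -/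

section Rational

variable {S : Set ℂ} {f g : ℂ → ℂ}

theorem IsRationalOn.const (c : ℂ) : IsRationalOn (fun _ => c) S :=
  ⟨.C c, 1, fun z _ => by simp⟩

theorem IsRationalOn.id : IsRationalOn (fun w => w) S :=
  ⟨.X, 1, fun z _ => by simp⟩

theorem IsRationalOn.add (hf : IsRationalOn f S) (hg : IsRationalOn g S) :
    IsRationalOn (fun w => f w + g w) S := by
  obtain ⟨p, q, h⟩ := hf
  obtain ⟨p', q', h'⟩ := hg
  refine ⟨p * q' + q * p', q * q', fun z hz => ?_⟩
  obtain ⟨h1, h2⟩ := h z hz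
  obtain ⟨h3, h4⟩ := h' z hz
  simp only [Polynomial.eval_mul, Polynomial.eval_add]
  exact ⟨mul_ne_zero h1 h3, by rw [h2, h4, div_add_div _ _ h1 h3]⟩

theorem IsRationalOn.mul (hf : IsRationalOn f S) (hg : IsRationalOn g S) :
    IsRationalOn (fun w => f w * g w) S := by
  obtain ⟨p, q, h⟩ := hf
  obtain ⟨p', q', h'⟩ := hg
  refine ⟨p * p', q * q', fun z hz => ?_⟩
  obtain ⟨h1, h2⟩ := h z hz
  obtain ⟨h3, h4⟩ := h' z hz
  simp only [Polynomial.eval_mul]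
  exact ⟨mul_ne_zero h1 h3, by rw [h2, h4, div_mul_div_comm]⟩

theorem IsRationalOn.inv (hf : IsRationalOn f S) (h0 : ∀ z ∈ S, f z ≠ 0) :
    IsRationalOn (fun w => (f w)⁻¹) S := by
  obtain ⟨p, q, h⟩ := hf
  refine ⟨q, p, fun z hz => ⟨fun hp => h0 z hz ?_, ?_⟩⟩
  · rw [(h z hz).2, hp, zero_div]
  · dsimp only
    rw [(h z hz).2, inv_div]

theorem IsRationalOn.sum {ι : Type*} (s : Finset ι) {f : ι → ℂ → ℂ}
    (hf : ∀ i, IsRationalOn (f i) S) : IsRationalOn (fun w => ∑ i ∈ s, f i w) S := by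
  classical
  induction s using Finset.induction_on with
  | empty => simpa using IsRationalOn.const 0
  | insert i s hi ih => simpa [Finset.sum_insert hi] using (hf i).add ih

theorem IsRationalOn.prod {ι : Type*} (s : Finset ι) {f : ι → ℂ → ℂ}
    (hf : ∀ i, IsRationalOn (f i) S) : IsRationalOn (fun w => ∏ i ∈ s, f i w) S := by
  classical
  induction s using Finset.induction_on with
  | empty => simpa using IsRationalOn.const 1
  | insert i s hi ih => simpa [Finset.prod_insert hi] using (hf i).mul ih

theorem IsRationalOn.det {ι : Type*} [Fintype ι] [DecidableEq ι] {M : ℂ → Matrix ι ι ℂ}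
    (hM : ∀ i j, IsRationalOn (fun w => M w i j) S) : IsRationalOn (fun w => (M w).det) S := by
  simp only [Matrix.det_apply']
  exact .sum _ fun σ => (IsRationalOn.const _).mul (.prod _ fun i => hM _ _)

/-- Cramer's rule: the entries of the adjugate are determinants of matrices with one row replaced by
constants. -/
theorem IsRationalOn.matrix_inv {ι : Type*} [Fintype ι] [DecidableEq ι] {M : ℂ → Matrix ι ι ℂ}
    (hM : ∀ i j, IsRationalOn (fun w => M w i j) S) (h0 : ∀ w ∈ S, (M w).det ≠ 0) (i j : ι) :
    IsRationalOn (fun w => (M w)⁻¹ i j) S := by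
  simp only [Matrix.inv_def, Matrix.smul_apply, Ring.inverse_eq_inv', smul_eq_mul,
    Matrix.adjugate_apply]
  refine ((IsRationalOn.det hM).inv h0).mul (.det fun k l => ?_)
  simp only [Matrix.updateRow_apply]
  split_ifs
  · exact .const _
  · exact hM k l

theorem IsRationalOn.differentiableOn (hf : IsRationalOn f S) : DifferentiableOn ℂ f S := by
  obtain ⟨p, q, h⟩ := hf
  exact (p.differentiable.differentiableOn.fun_div q.differentiable.differentiableOn
    fun z hz => (h z hz).1).congr fun z hz => (h z hz).2

end Rational

/-! ### Transfer functions of isometric matrices. -/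

section Realization

variable {κ : Type*} [Fintype κ] [DecidableEq κ]

/-- The vector with first entry `a` and further entries `x`. -/
def optionVec {κ E : Type*} (a : E) (x : κ → E) : Option κ → E := fun o => o.elim a x

/-- A kernel vector `x` would make `V` send `(0, e x)` to a vector with lower part `x`, so `‖x‖ ≤ ‖e
x‖`; but `‖e x‖ < ‖x‖` for `x ≠ 0`. -/
theorem det_one_sub_ne_zero {V : Matrix (Option κ) (Option κ) ℂ} (hV : Vᴴ * V = 1) {e : κ → ℂ}
    (he : ∀ k, ‖e k‖ < 1) : (1 - of fun k l => V (some k) (some l) * e l).det ≠ 0 := by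
  intro h0
  obtain ⟨x, hx0, hx⟩ := Matrix.exists_mulVec_eq_zero_iff.2 h0
  have hx' : ∀ k, ∑ l, V (some k) (some l) * (e l * x l) = x k := by
    intro k
    have := congrFun hx k
    rw [sub_mulVec, one_mulVec, Pi.sub_apply, Pi.zero_apply, sub_eq_zero] at this
    rw [this]
    simp [mulVec, dotProduct, mul_assoc]
  have h1 := sum_norm_sq_isometry hV (optionVec 0 fun k => e k * x k)
  simp only [Fintype.sum_option, optionVec, Option.elim, smul_eq_mul, mul_zero, zero_add, hx',
    norm_zero, ne_eq, OfNat.ofNat_ne_zero, not_false_eq_true, zero_pow] at h1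
  have h2 : ∑ k, ‖x k‖ ^ 2 ≤ ∑ k, ‖e k * x k‖ ^ 2 := by
    rw [← h1]
    exact le_add_of_nonneg_left (sq_nonneg _)
  obtain ⟨k, hk⟩ := Function.ne_iff.1 hx0
  have hk' : 0 < ‖x k‖ := norm_pos_iff.2 hk
  refine h2.not_gt (Finset.sum_lt_sum (fun i _ => ?_) ⟨k, Finset.mem_univ k, ?_⟩)
  · rw [norm_mul]
    exact pow_le_pow_left₀ (by positivity) (mul_le_of_le_one_left (norm_nonneg _) (he i).le) 2
  · rw [norm_mul]
    exact pow_lt_pow_left₀ (mul_lt_of_lt_one_left hk' (he k)) (by positivity) two_ne_zero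

/-- The realization of a rational function by an isometric matrix. -/
theorem exists_realization {S : Set ℂ} {V : Matrix (Option κ) (Option κ) ℂ} (hV : Vᴴ * V = 1)
    {e : κ → ℂ → ℂ} (he : ∀ k, IsRationalOn (e k) S) (he1 : ∀ k, ∀ w ∈ S, ‖e k w‖ < 1) :
    ∃ (φ : ℂ → ℂ) (u : κ → ℂ → ℂ), IsRationalOn φ S ∧ (∀ k, IsRationalOn (u k) S) ∧
      (∀ w ∈ S, V *ᵥ optionVec 1 (fun k => e k w * u k w) = optionVec (φ w) (fun k => u k w)) ∧
      ∀ w ∈ S, ∀ (a : ℂ) (x : κ → ℂ),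
        V *ᵥ optionVec 1 (fun k => e k w * x k) = optionVec a x → a = φ w := by
  -- The lower block of `V (1, e u) = (φ, u)` reads `W u = γ`; it determines `u`, and the top row
  -- then determines `φ`. This gives both existence and uniqueness.
  set W : ℂ → Matrix κ κ ℂ := fun w => 1 - of fun k l => V (some k) (some l) * e l w with hW
  set γ : κ → ℂ := fun k => V (some k) none with hγ
  have hdet : ∀ w ∈ S, (W w).det ≠ 0 := fun w hw =>
    det_one_sub_ne_zero hV fun k => he1 k w hw
  have hWr : ∀ k l, IsRationalOn (fun w => W w k l) S := by
    intro k l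
    have : (fun w => W w k l) =
        fun w => (1 : Matrix κ κ ℂ) k l + (-V (some k) (some l)) * e l w := by
      funext w
      simp only [hW, Matrix.sub_apply, of_apply]
      ring
    rw [this]
    exact (IsRationalOn.const _).add ((IsRationalOn.const _).mul (he l))
  set u : κ → ℂ → ℂ := fun k w => ((W w)⁻¹ *ᵥ γ) k with hu
  have hur : ∀ k, IsRationalOn (u k) S := fun k =>
    .sum _ fun l => (IsRationalOn.matrix_inv hWr hdet k l).mul (.const _)
  set φ : ℂ → ℂ := fun w => V none none + ∑ l, V none (some l) * (e l w * u l w) with hφ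
  have hWx : ∀ (w : ℂ) (x : κ → ℂ) (k : κ),
      (W w *ᵥ x) k = x k - ∑ l, V (some k) (some l) * (e l w * x l) := by
    intro w x k
    simp only [hW]
    rw [sub_mulVec, one_mulVec, Pi.sub_apply]
    simp [mulVec, dotProduct, mul_assoc]
  have hsome : ∀ (w : ℂ) (x : κ → ℂ) (k : κ), (V *ᵥ optionVec 1 (fun k => e k w * x k)) (some k) =
      γ k + ∑ l, V (some k) (some l) * (e l w * x l) := by
    intro w x k
    simp [mulVec, dotProduct, Fintype.sum_option, optionVec, hγ]
  have hnone : ∀ (w : ℂ) (x : κ → ℂ), (V *ᵥ optionVec 1 (fun k => e k w * x k)) none =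
      V none none + ∑ l, V none (some l) * (e l w * x l) := by
    intro w x
    simp [mulVec, dotProduct, Fintype.sum_option, optionVec]
  have hWu : ∀ w ∈ S, W w *ᵥ (fun k => u k w) = γ := by
    intro w hw
    change W w *ᵥ ((W w)⁻¹ *ᵥ γ) = γ
    rw [mulVec_mulVec, mul_nonsing_inv _ (isUnit_iff_ne_zero.2 (hdet w hw)), one_mulVec]
  refine ⟨φ, u, (IsRationalOn.const _).add (.sum _ fun l => (IsRationalOn.const _).mul
    ((he l).mul (hur l))), hur, fun w hw => ?_, fun w hw a x h => ?_⟩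
  · funext o
    cases o with
    | none => exact hnone w _
    | some k =>
      have := congrFun (hWu w hw) k
      rw [hWx] at this
      rw [hsome, ← this]
      exact sub_add_cancel _ _
  · have hx : W w *ᵥ x = γ := by
      funext k
      have := congrFun h (some k)
      rw [hsome] at this
      rw [hWx, sub_eq_iff_eq_add, this]
      rfl
    have hxu : x = fun k => u k w := by
      change x = (W w)⁻¹ *ᵥ γ
      rw [← hx, mulVec_mulVec, nonsing_inv_mul _ (isUnit_iff_ne_zero.2 (hdet w hw)), one_mulVec]
    have := congrFun h none
    rw [hnone, hxu] at this
    exact this.symm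

end Realization

/-! ### Contractivity and isometries in the functional calculus. -/

section Schur

variable {H : Type*} [NormedAddCommGroup H] [InnerProductSpace ℂ H] [CompleteSpace H] {δ : ℝ}
  {X : H →L[ℂ] H}

theorem norm_holCalc_id_mul_apply_le (hδ : 0 < δ) (hδ1 : δ < 1) (hX : IsDPFamily δ X) {f : ℂ → ℂ}
    (hf : DifferentiableOn ℂ f (annulus δ)) (x : H) :
    ‖holCalc δ (fun w => w * f w) X x‖ ≤ ‖holCalc δ f X x‖ := by
  rw [holCalc_id_mul hδ hδ1 hX.2 hf]
  exact (X.le_of_opNorm_le hX.1.2.1 _).trans_eq (one_mul _)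

/-- Multiplying by `X` turns `δ / w * f` into `δ f`, so the operator is `δ X⁻¹ f(X)`, and `‖δ X⁻¹‖ ≤
1`. -/
theorem norm_holCalc_div_mul_apply_le (hδ : 0 < δ) (hδ1 : δ < 1) (hX : IsDPFamily δ X)
    {f : ℂ → ℂ} (hf : DifferentiableOn ℂ f (annulus δ)) (x : H) :
    ‖holCalc δ (fun w => δ / w * f w) X x‖ ≤ ‖holCalc δ f X x‖ := by
  have hg : DifferentiableOn ℂ (fun w : ℂ => δ / w * f w) (annulus δ) :=
    ((differentiableOn_const _).fun_div differentiableOn_id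
      fun w hw => ne_zero_of_mem_annulus hδ hw).mul hf
  have h1 : X * holCalc δ (fun w => δ / w * f w) X = (δ : ℂ) • holCalc δ f X := by
    rw [← holCalc_id_mul hδ hδ1 hX.2 hg]
    have h2 := holCalc_sum hδ hδ1 hX.2 (Finset.univ : Finset Unit) (fun _ => (δ : ℂ))
      (g := fun _ => f) (fun _ => hf)
    simp only [Finset.univ_unique, Finset.sum_singleton] at h2
    rw [← h2]
    refine holCalc_congr hδ hδ1 hX.2 (differentiableOn_id.mul hg) fun w hw => ?_
    have := ne_zero_of_mem_annulus hδ hw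
    field_simp
  have h2 : holCalc δ (fun w => δ / w * f w) X = (δ : ℂ) • (Ring.inverse X * holCalc δ f X) := by
    rw [← mul_smul_comm, ← h1, ← mul_assoc, Ring.inverse_mul_cancel _ hX.1.1, one_mul]
  rw [h2]
  change ‖(δ : ℂ) • (Ring.inverse X) (holCalc δ f X x)‖ ≤ _
  rw [norm_smul, Complex.norm_real, Real.norm_of_nonneg hδ.le]
  refine (mul_le_mul_of_nonneg_left ((Ring.inverse X).le_of_opNorm_le hX.1.2.2 _) hδ.le).trans_eq ?_
  field_simp

theorem sum_norm_sq_holCalc_isometry (hδ : 0 < δ) (hδ1 : δ < 1) (hX : spectrum ℂ X ⊆ annulus δ)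
    {κ : Type*} [Fintype κ] [DecidableEq κ] {V : Matrix κ κ ℂ} (hV : Vᴴ * V = 1)
    {g h : κ → ℂ → ℂ} (hg : ∀ k, DifferentiableOn ℂ (g k) (annulus δ))
    (hgh : ∀ w ∈ annulus δ, V *ᵥ (fun k => g k w) = fun k => h k w) (x : H) :
    ∑ k, ‖holCalc δ (h k) X x‖ ^ 2 = ∑ k, ‖holCalc δ (g k) X x‖ ^ 2 := by
  rw [← sum_norm_sq_isometry hV fun k => holCalc δ (g k) X x]
  refine Finset.sum_congr rfl fun k _ => ?_
  have h1 : holCalc δ (h k) X = ∑ j, V k j • holCalc δ (g j) X := by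
    rw [← holCalc_sum hδ hδ1 hX _ _ hg]
    exact (holCalc_congr hδ hδ1 hX (DifferentiableOn.fun_sum fun j _ => (hg j).const_mul _)
      fun w hw => congrFun (hgh w hw) k).symm
  rw [h1]
  simp

end Schur

/-! ### Norm bound, model and interpolation from one isometry. -/

variable {δ : ℝ}

/-- The multipliers `w` and `δ / w` on the two summands of the model space. -/
def modelMultiplier (δ : ℝ) {ι κ : Type*} : ι ⊕ κ → ℂ → ℂ :=
  Sum.elim (fun _ w => w) (fun _ w => δ / w)

/-- Applying `V` to functions of `X` gives `‖φ(X)x‖² + ∑ ‖uₖ(X)x‖² = ‖x‖² + ∑ ‖(eₖuₖ)(X)x‖²`. Each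
`eₖ(X)` is `X` or `δ X⁻¹`, a contraction, so the last sum is at most the sum on the left. -/
theorem mem_dpSchur_of_isometry (hδ : 0 < δ) (hδ1 : δ < 1) {ι κ : Type*} [Fintype ι] [Fintype κ]
    [DecidableEq ι] [DecidableEq κ] {V : Matrix (Option (ι ⊕ κ)) (Option (ι ⊕ κ)) ℂ}
    (hV : Vᴴ * V = 1) {φ : ℂ → ℂ} {u : ι ⊕ κ → ℂ → ℂ} (hφ : DifferentiableOn ℂ φ (annulus δ))
    (hu : ∀ k, DifferentiableOn ℂ (u k) (annulus δ))
    (h : ∀ w ∈ annulus δ, V *ᵥ optionVec 1 (fun k => modelMultiplier δ k w * u k w) =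
      optionVec (φ w) (fun k => u k w)) : φ ∈ dpSchur.{v} δ := by
  refine ⟨hφ, ?_⟩
  simp only [dpNorm, iSup_le_iff]
  intro H _ _ _ X hX
  rw [ENNReal.ofReal_le_one]
  refine ContinuousLinearMap.opNorm_le_bound _ zero_le_one fun x => ?_
  rw [one_mul]
  refine le_of_sq_le_sq ?_ (norm_nonneg _)
  set g : Option (ι ⊕ κ) → ℂ → ℂ :=
    optionVec (fun _ => 1) (fun k w => modelMultiplier δ k w * u k w) with hg
  have hgd : ∀ k, DifferentiableOn ℂ (g k) (annulus δ) := by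
    rintro (_ | k | k)
    · exact differentiableOn_const _
    · exact differentiableOn_id.mul (hu _)
    · exact ((differentiableOn_const _).fun_div differentiableOn_id
        fun w hw => ne_zero_of_mem_annulus hδ hw).mul (hu _)
  have hsum := sum_norm_sq_holCalc_isometry hδ hδ1 hX.2 hV (g := g) (h := optionVec φ u) hgd
    (fun w hw => by
      have e1 : (fun k => g k w) = optionVec 1 (fun k => modelMultiplier δ k w * u k w) := by
        funext k; cases k <;> rfl
      have e2 : (fun k => optionVec φ u k w) = optionVec (φ w) (fun k => u k w) := by
        funext k; cases k <;> rfl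
      rw [e1, e2, h w hw]) x
  simp only [Fintype.sum_option] at hsum
  have h0 : holCalc δ (g none) X = 1 := holCalc_one hδ hδ1 hX.2
  have hk : ∀ k, ‖holCalc δ (g (some k)) X x‖ ^ 2 ≤ ‖holCalc δ (u k) X x‖ ^ 2 := by
    intro k
    refine pow_le_pow_left₀ (norm_nonneg _) ?_ 2
    rcases k with k | k
    · exact norm_holCalc_id_mul_apply_le hδ hδ1 hX (hu _) x
    · exact norm_holCalc_div_mul_apply_le hδ hδ1 hX (hu _) x
  rw [h0] at hsum
  simp only [optionVec, Option.elim] at hsum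
  have := Finset.sum_le_sum fun k (_ : k ∈ Finset.univ) => hk k
  rw [one_apply_eq_self] at hsum
  linarith

/-- The map into the model space with given coordinate functions. -/
def modelMap {ι κ : Type*} (u : ι ⊕ κ → ℂ → ℂ) (w : ℂ) :
    WithLp 2 (EuclideanSpace ℂ ι × EuclideanSpace ℂ κ) :=
  (WithLp.prodContinuousLinearEquiv 2 ℂ (EuclideanSpace ℂ ι) (EuclideanSpace ℂ κ)).symm
    (WithLp.toLp 2 fun k => u (Sum.inl k) w, WithLp.toLp 2 fun k => u (Sum.inr k) w)

theorem differentiableOn_modelMap {ι κ : Type*} [Fintype ι] [Fintype κ] {u : ι ⊕ κ → ℂ → ℂ}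
    {S : Set ℂ} (hu : ∀ k, DifferentiableOn ℂ (u k) S) : DifferentiableOn ℂ (modelMap u) S := by
  refine ContinuousLinearEquiv.comp_differentiableOn_iff _ |>.2 (DifferentiableOn.prodMk ?_ ?_) <;>
    exact differentiableOn_euclidean.2 fun k => hu _

theorem inner_modelMap {ι κ : Type*} [Fintype ι] [Fintype κ] (u u' : ι ⊕ κ → ℂ → ℂ) (m w : ℂ) :
    ⟪modelMap u m, modelMap u' w⟫_ℂ = ∑ k, ⟪u k m, u' k w⟫_ℂ := by
  rw [WithLp.prod_inner_apply, Fintype.sum_sum_type]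
  rfl

theorem modelOp_modelMap {ι κ : Type*} [Fintype ι] [Fintype κ] (u : ι ⊕ κ → ℂ → ℂ) (w : ℂ) :
    modelOp δ (EuclideanSpace ℂ ι) (EuclideanSpace ℂ κ) w (modelMap u w) =
      modelMap (fun k w => modelMultiplier δ k w * u k w) w := by
  rfl

/-- Preservation of the inner product of `(1, E u)` at `m` and at `w` is the model identity with its
terms rearranged. -/
theorem isDPModel_of_isometry {ι κ : Type*} [Fintype ι] [Fintype κ]
    [DecidableEq ι] [DecidableEq κ] {V : Matrix (Option (ι ⊕ κ)) (Option (ι ⊕ κ)) ℂ}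
    (hV : Vᴴ * V = 1) {φ : ℂ → ℂ} {u : ι ⊕ κ → ℂ → ℂ}
    (h : ∀ w ∈ annulus δ, V *ᵥ optionVec 1 (fun k => modelMultiplier δ k w * u k w) =
      optionVec (φ w) (fun k => u k w)) : IsDPModel δ φ (modelMap u) := by
  intro w hw m hm
  rw [_root_.sub_apply, inner_sub_right, one_apply_eq_self,
    mul_apply_eq_comp, ContinuousLinearMap.adjoint_inner_right, modelOp_modelMap,
    modelOp_modelMap, inner_modelMap, inner_modelMap]
  have h1 := sum_inner_isometry hV
    (optionVec (1 : ℂ) fun k => modelMultiplier δ k m * u k m)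
    (optionVec (1 : ℂ) fun k => modelMultiplier δ k w * u k w)
  have h2 : ∀ w ∈ annulus δ, ∀ i, ∑ j, V i j • optionVec (1 : ℂ)
      (fun k => modelMultiplier δ k w * u k w) j = optionVec (φ w) (fun k => u k w) i :=
    fun w hw i => congrFun (h w hw) i
  simp only [h2 w hw, h2 m hm, Fintype.sum_option] at h1
  simp only [optionVec, Option.elim] at h1
  have e1 : ⟪φ m, φ w⟫_ℂ = conj (φ m) * φ w := by
    rw [RCLike.inner_apply, mul_comm]
  have e2 : ⟪(1 : ℂ), (1 : ℂ)⟫_ℂ = 1 := by simp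
  rw [e1, e2] at h1
  linear_combination -h1

/-- A decomposition of the Pick matrix yields an isometry interpolating the data. -/
theorem exists_interpolating_isometry {ι : Type*} [Fintype ι] [DecidableEq ι] {l z : ι → ℂ}
    (h : szegoWeight z ∈ pickCone l (fun i => δ / l i)) :
    ∃ V : Matrix (Option (ι ⊕ ι)) (Option (ι ⊕ ι)) ℂ, Vᴴ * V = 1 ∧
      ∃ x : ι → ι ⊕ ι → ℂ, ∀ j, V *ᵥ optionVec 1 (fun k => modelMultiplier δ k (l j) * x j k) =
        optionVec (z j) (x j) := by
  obtain ⟨A, B, hA, hB, hAB⟩ := h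
  obtain ⟨a, rfl⟩ := CStarAlgebra.nonneg_iff_eq_star_mul_self.mp hA.nonneg
  obtain ⟨b, rfl⟩ := CStarAlgebra.nonneg_iff_eq_star_mul_self.mp hB.nonneg
  set x : ι → ι ⊕ ι → ℂ := fun j => Sum.elim (fun k => a k j) (fun k => b k j) with hx
  set P : Matrix (Option (ι ⊕ ι)) ι ℂ :=
    of fun o j => optionVec 1 (fun k => modelMultiplier δ k (l j) * x j k) o with hP
  set Q : Matrix (Option (ι ⊕ ι)) ι ℂ := of fun o j => optionVec (z j) (x j) o with hQ
  -- This is the decomposition of the Pick matrix with every negative term moved to the other side.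
  have hPQ : Pᴴ * P = Qᴴ * Q := by
    ext i j
    have hij := congrFun (congrFun hAB i) j
    simp only [szegoWeight, of_apply, Matrix.add_apply, hadamard_apply, Matrix.mul_apply,
      star_eq_conjTranspose, conjTranspose_apply, sub_mul, one_mul, Finset.mul_sum,
      Finset.sum_sub_distrib] at hij
    simp only [Matrix.mul_apply, conjTranspose_apply, hP, hQ, of_apply, Fintype.sum_option,
      Fintype.sum_sum_type, optionVec, Option.elim, hx, Sum.elim_inl, Sum.elim_inr,
      modelMultiplier, RCLike.star_def, map_one, mul_one] at hij ⊢
    have e1 : ∑ k, conj (l i * a k i) * (l j * a k j) =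
        ∑ k, conj (l i) * l j * (conj (a k i) * a k j) :=
      Finset.sum_congr rfl fun k _ => by rw [map_mul]; ring
    have e2 : ∑ k, conj (δ / l i * b k i) * (δ / l j * b k j) =
        ∑ k, conj (δ / l i : ℂ) * (δ / l j) * (conj (b k i) * b k j) :=
      Finset.sum_congr rfl fun k _ => by rw [map_mul]; ring
    rw [e1, e2]
    linear_combination hij
  obtain ⟨V, hV, hVP⟩ := exists_isometry_mul_eq hPQ
  refine ⟨V, hV, x, fun j => ?_⟩
  funext o
  exact congrFun (congrFun hVP o) j

theorem isRationalOn_modelMultiplier (hδ : 0 < δ) {ι κ : Type*} (k : ι ⊕ κ) :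
    IsRationalOn (modelMultiplier δ k) (annulus δ) := by
  rcases k with k | k
  · exact .id
  · exact (IsRationalOn.const (δ : ℂ)).mul (IsRationalOn.id.inv
      fun w hw => ne_zero_of_mem_annulus hδ hw)

theorem norm_modelMultiplier_lt_one (hδ : 0 < δ) {ι κ : Type*} (k : ι ⊕ κ) {w : ℂ}
    (hw : w ∈ annulus δ) : ‖modelMultiplier δ k w‖ < 1 := by
  rcases k with k | k
  · exact hw.2
  · exact norm_div_lt_one hδ hw

theorem pickCone_submatrix {ι κ : Type*} (e : κ → ι) {l m z : ι → ℂ}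
    (h : szegoWeight z ∈ pickCone l m) :
    szegoWeight (z ∘ e) ∈ pickCone (l ∘ e) (m ∘ e) := by
  obtain ⟨A, B, hA, hB, hAB⟩ := h
  exact ⟨A.submatrix e e, B.submatrix e e, hA.submatrix e, hB.submatrix e,
    congrArg (fun M => M.submatrix e e) hAB⟩

end DouglasPaulsen

end

theorem theorem5p3 (δ : ℝ) (hδ0 : 0 < δ) (hδ1 : δ < 1) (n : ℕ)
    (lam z : Fin n → ℂ) (hlam : ∀ j, lam j ∈ DouglasPaulsen.annulus δ)
    (hinj : Function.Injective lam)
    (hsolv : DouglasPaulsen.DPPickSolvable.{v} δ lam z) :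
    ∃ φ ∈ DouglasPaulsen.dpSchur.{v} δ,
      DouglasPaulsen.IsRationalOn φ (DouglasPaulsen.annulus δ) ∧
      (∀ j, φ (lam j) = z j) ∧
      ∃ (M₁ M₂ : Type) (_ : NormedAddCommGroup M₁) (_ : InnerProductSpace ℂ M₁)
        (_ : CompleteSpace M₁) (_ : NormedAddCommGroup M₂) (_ : InnerProductSpace ℂ M₂)
        (_ : CompleteSpace M₂) (_ : FiniteDimensional ℂ (WithLp 2 (M₁ × M₂)))
        (u : ℂ → WithLp 2 (M₁ × M₂)),
        Module.finrank ℂ (WithLp 2 (M₁ × M₂)) ≤ 2 * n ∧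
        DifferentiableOn ℂ u (DouglasPaulsen.annulus δ) ∧
        DouglasPaulsen.IsDPModel δ φ u := by
  open DouglasPaulsen in
  obtain ⟨f, hf, hfz⟩ := hsolv
  -- The test operators must act on a space in universe `v`, so the nodes are indexed by `ULift (Fin
  -- n)` and the decomposition is pulled back to `Fin n`.
  have hcone := pickCone_submatrix (ULift.up.{v} : Fin n → _)
    (szegoWeight_mem_pickCone hδ0 hδ1 (l := fun i : ULift.{v} (Fin n) => lam i.down)
      (fun i => hlam _) hf)
  have hz : (f ∘ fun i : ULift.{v} (Fin n) => lam i.down) ∘ ULift.up = z := funext hfz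
  rw [hz] at hcone
  obtain ⟨V, hV, x, hx⟩ := exists_interpolating_isometry (l := lam) hcone
  obtain ⟨φ, u, hφ, hu, hmodel, huniq⟩ := exists_realization hV
    (isRationalOn_modelMultiplier hδ0) (fun k w => norm_modelMultiplier_lt_one hδ0 k)
  -- At `lam j` the vector `x j` with value `z j` already solves the equation defining `φ`, so
  -- uniqueness gives interpolation. Two copies of `ℂⁿ` account for the dimension `2 * n`.
  refine ⟨φ, mem_dpSchur_of_isometry hδ0 hδ1 hV hφ.differentiableOn
    (fun k => (hu k).differentiableOn) hmodel, hφ, fun j => (huniq _ (hlam j) _ _ (hx j)).symm,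
    EuclideanSpace ℂ (Fin n), EuclideanSpace ℂ (Fin n), inferInstance, inferInstance,
    inferInstance, inferInstance, inferInstance, inferInstance,
    (WithLp.linearEquiv 2 ℂ _).symm.finiteDimensional, modelMap u, ?_,
    differentiableOn_modelMap fun k => (hu k).differentiableOn, isDPModel_of_isometry hV hmodel⟩
  rw [(WithLp.linearEquiv 2 ℂ (EuclideanSpace ℂ (Fin n) × EuclideanSpace ℂ (Fin n))).finrank_eq,
    Module.finrank_prod, finrank_euclideanSpace_fin, two_mul]
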